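/- **Proposition 2.7.** Let $X=l^2$ be the complex Hilbert space of square summable sequences $x=(x_k)_{k\in\mathbb N}$, $\mathbb N=\{1,2,3,\dots\}$, let $a>0$, and let $A:D(A)\to X$ be given by $$(Ax)_k = i a k^2 x_k,\qquad D(A)=\Big\{x\in l^2 \ \Big|\ \sum_{k\in\mathbb N}k^4|x_k|^2<\infty\Big\}.$$ Then $A$ is the generator of the strongly continuous diagonal unitary group $(\mathbb T_t x)_k=e^{iak^2t}x_k$. Fix $\beta\in\rho(A)$. Let $X_1$ be $D(A)$ with the norm $\|(\beta I-A)x\|$ and let $X_{-1}$ be the completion of $X$ in the norm $\|(\beta I-A)^{-1}x\|$; the operators $A$, $\mathbb T_t$, $(sI-A)^{-1}$ extend by continuity to $X\to X_{-1}$, $X_{-1}\to X_{-1}$, $X_{-1}\to X$, respectively. Let $B\in X_{-1}$ be an admissible control operator for $\mathbb T$ (input space $\mathbb C$), i.e. for some $\tau>0$, $\int_0^\tau \mathbb T_{\tau-s}Bu(s)\,ds\in X$ for all $u\in L^2[0,\infty)$, and let the bounded linear functional $C:X_1\to\mathbb C$ be an admissible observation operator for $\mathbb T$, i.e. for some $\tau>0$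 and $m_\tau>0$, $\int_0^\tau|C\mathbb T_tx|^2dt\le m_\tau\|x\|^2$ for all $x\in D(A)$. Let $C_\Lambda x=\lim_{\lambda\to\infty}C\lambda(\lambda I-A)^{-1}x$ ($\lambda$ real), with domain the set of all $x\in X$ for which the limit exists. Then: 1. $(A,B,C_\Lambda,0)$ is a compatible system node: the space $Z=D(A)+(\beta I-A)^{-1}B\,\mathbb C$, with the norm $\|z\|_Z^2=\inf\{\|(\beta I-A)x\|^2+|v|^2 : x\in D(A),\ v\in\mathbb C,\ z=x+(\beta I-A)^{-1}Bv\}$, is contained in $D(C_\Lambda)$, and the restriction of $C_\Lambda$ to $Z$ is bounded on $Z$. 2. It is well-posed: for every $\tau>0$ there is $K_\tau>0$ such that $$\|x(\tau)\|^2+\int_0^\tau|y(t)|^2dt\le K_\tau\Big(\|x(0)\|^2+\int_0^\tau|u(t)|^2dt\Big)$$ for all classical solutions $(x,u,y)$ of $\dot x=Ax+Bu$, $y=C_\Lambda x$, that is, for all $x\in C^1([0,\infty);X)$ and $u,y\in C[0,\infty)$ such that for all $t\ge0$: $Ax(t)+Bu(t)\in X$, $\dot x(t)=Ax(t)+Bu(t)$,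 $x(t)\in D(C_\Lambda)$ and $y(t)=C_\Lambda x(t)$. 3. It is strictly proper: its transfer function $G(s)=C_\Lambda(sI-A)^{-1}B$ satisfies $|G(s)|\to0$ as $\operatorname{Re}s\to\infty$, uniformly with respect to $\operatorname{Im}s$. 4. Let $b_k$ be the components of $B$ (the values at $B$ of the continuous extensions to $X_{-1}$ of $x\mapsto x_k$) and let $c_k=Ce_k$, where $(e_k)$ is the standard basis of $l^2$. Then $m=\sup_{k\in\mathbb N}|b_kc_k|<\infty$, every $s\in\mathbb C$ with $\operatorname{Re}s>0$ is in $\rho(A)$, and for all such $s$ $$|G(s)|\ \le\ \frac{2\sqrt2\,m}{a}\sum_{k=0}^{\infty}\frac{1}{\operatorname{Re}s/a+k^2}.$$ -/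

import Mathlib

open Set Filter Topology MeasureTheory
open scoped ENNReal

noncomputable section

namespace SysNode

section General

variable {U X Y : Type*}
  [NormedAddCommGroup U] [InnerProductSpace ℂ U] [CompleteSpace U]
  [NormedAddCommGroup X] [InnerProductSpace ℂ X] [CompleteSpace X]
  [NormedAddCommGroup Y] [InnerProductSpace ℂ Y] [CompleteSpace Y]

/-! ### Semigroups and generators -/

/-- `T t`, for `t ≥ 0`, is a strongly continuous semigroup of bounded operators on `X`
(the values of `T` at negative times are irrelevant). -/
structure IsC0Semigroup (T : ℝ → X →L[ℂ] X) : Prop where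
  zero : T 0 = 1
  add : ∀ s t : ℝ, 0 ≤ s → 0 ≤ t → T (s + t) = T s * T t
  cont : ∀ x : X, ContinuousOn (fun t => T t x) (Ici 0)

/-- `T t`, for `t ∈ ℝ`, is a strongly continuous group of unitary operators on `X`. -/
structure IsUnitaryGroup (T : ℝ → X →L[ℂ] X) : Prop where
  zero : T 0 = 1
  add : ∀ s t : ℝ, T (s + t) = T s * T t
  cont : ∀ x : X, Continuous fun t => T t x
  unitary : ∀ t : ℝ, T t ∈ unitary (X →L[ℂ] X)

/-- `A` (with its domain) is the infinitesimal generator of `T`: the right derivative of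
`t ↦ T t x` at `0` exists and equals `y` if and only if `x ∈ D(A)` and `A x = y`. -/
def IsGenerator (T : ℝ → X →L[ℂ] X) (A : X →ₗ.[ℂ] X) : Prop :=
  ∀ x y : X, (∃ h : x ∈ A.domain, A ⟨x, h⟩ = y) ↔
    Tendsto (fun t : ℝ => (t : ℂ)⁻¹ • (T t x - x)) (𝓝[>] 0) (𝓝 y)

/-! ### Partially defined operators and resolvents -/

open Classical in
/-- A partially defined linear operator, extended by `0` outside of its domain. -/
def applyOrZero (f : X →ₗ.[ℂ] Y) (x : X) : Y :=
  if h : x ∈ f.domain then f ⟨x, h⟩ else 0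

/-- The operator `β I - A : D(A) → X`. -/
def shift (A : X →ₗ.[ℂ] X) (β : ℂ) : A.domain →ₗ[ℂ] X :=
  β • A.domain.subtype - A.toFun

/-- `R` is the bounded, everywhere defined inverse of `s I - A`. -/
def IsResolvent (A : X →ₗ.[ℂ] X) (s : ℂ) (R : X →L[ℂ] X) : Prop :=
  (∀ x : X, ∃ h : R x ∈ A.domain, shift A s ⟨R x, h⟩ = x) ∧
    ∀ x : A.domain, R (shift A s x) = x

/-- The resolvent set `ρ(A)`. -/
def resolventSet (A : X →ₗ.[ℂ] X) : Set ℂ := {s | ∃ R : X →L[ℂ] X, IsResolvent A s R}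

open Classical in
/-- The resolvent operator `(s I - A)⁻¹ ∈ L(X)`, for `s ∈ ρ(A)` (and `0` otherwise). -/
def resolvent (A : X →ₗ.[ℂ] X) (s : ℂ) : X →L[ℂ] X :=
  if h : s ∈ resolventSet A then Classical.choose h else 0

set_option linter.unusedSectionVars false in
theorem resolvent_mem (A : X →ₗ.[ℂ] X) (s : ℂ) (x : X) : resolvent A s x ∈ A.domain := by
  unfold resolvent
  split_ifs with h
  · exact ((Classical.choose_spec h).1 x).1
  · simp

/-! ### The spaces `X₁` and `X₋₁` -/

/-- The space `X₁`: the domain `D(A)`, normed by `‖x‖₁ = ‖(β I - A) x‖`. -/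
def XOne (A : X →ₗ.[ℂ] X) (_β : ℂ) : Type _ := A.domain

instance (A : X →ₗ.[ℂ] X) (β : ℂ) : AddCommGroup (XOne A β) :=
  inferInstanceAs (AddCommGroup A.domain)

instance (A : X →ₗ.[ℂ] X) (β : ℂ) : Module ℂ (XOne A β) :=
  inferInstanceAs (Module ℂ A.domain)

/-- `β I - A`, as a map from `X₁` to `X`. -/
def XOne.shift (A : X →ₗ.[ℂ] X) (β : ℂ) : XOne A β →ₗ[ℂ] X := SysNode.shift A β

instance (A : X →ₗ.[ℂ] X) (β : ℂ) : SeminormedAddCommGroup (XOne A β) :=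
  SeminormedAddCommGroup.induced (XOne A β) X (XOne.shift A β)

instance (A : X →ₗ.[ℂ] X) (β : ℂ) : NormedSpace ℂ (XOne A β) :=
  NormedSpace.induced ℂ (XOne A β) X (XOne.shift A β)

/-- The vector space `X` with the weaker norm `‖x‖₋₁ = ‖(β I - A)⁻¹ x‖`. -/
def PreNeg (_A : X →ₗ.[ℂ] X) (_β : ℂ) : Type _ := X

instance (A : X →ₗ.[ℂ] X) (β : ℂ) : AddCommGroup (PreNeg A β) :=
  inferInstanceAs (AddCommGroup X)

instance (A : X →ₗ.[ℂ] X) (β : ℂ) : Module ℂ (PreNeg A β) :=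
  inferInstanceAs (Module ℂ X)

/-- The identity map from `X` with its own norm to `X` with the norm `‖·‖₋₁`. -/
def toPreNeg (A : X →ₗ.[ℂ] X) (β : ℂ) : X ≃ₗ[ℂ] PreNeg A β := LinearEquiv.refl ℂ X

instance (A : X →ₗ.[ℂ] X) (β : ℂ) : SeminormedAddCommGroup (PreNeg A β) :=
  SeminormedAddCommGroup.induced (PreNeg A β) X
    ((resolvent A β).toLinearMap ∘ₗ (toPreNeg A β).symm.toLinearMap)

instance (A : X →ₗ.[ℂ] X) (β : ℂ) : NormedSpace ℂ (PreNeg A β) :=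
  NormedSpace.induced ℂ (PreNeg A β) X
    ((resolvent A β).toLinearMap ∘ₗ (toPreNeg A β).symm.toLinearMap)

/-- The space `X₋₁`: the completion of `X` with respect to `‖·‖₋₁`. -/
abbrev XNeg (A : X →ₗ.[ℂ] X) (β : ℂ) : Type _ := UniformSpace.Completion (PreNeg A β)

/-- The embedding of `X` into `X₋₁`. -/
def toXNeg (A : X →ₗ.[ℂ] X) (β : ℂ) (x : X) : XNeg A β :=
  ((toPreNeg A β x : PreNeg A β) : XNeg A β)

/-- The extension of `A` by continuity to an operator from `X` to `X₋₁`. -/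
def genExt (A : X →ₗ.[ℂ] X) (β : ℂ) : X → XNeg A β :=
  extendFrom (A.domain : Set X) fun x => toXNeg A β (applyOrZero A x)

/-- The extension of `T t` by continuity to an operator on `X₋₁`. -/
def semigroupExt (A : X →ₗ.[ℂ] X) (β : ℂ) (T : ℝ → X →L[ℂ] X) (t : ℝ) : XNeg A β → XNeg A β :=
  UniformSpace.Completion.extension fun x : PreNeg A β =>
    toXNeg A β (T t ((toPreNeg A β).symm x))

/-- The extension of `(s I - A)⁻¹` by continuity to an operator from `X₋₁` to `X`. -/
def resolventExt (A : X →ₗ.[ℂ] X) (β s : ℂ) : XNeg A β → X :=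
  UniformSpace.Completion.extension fun x : PreNeg A β =>
    resolvent A s ((toPreNeg A β).symm x)

/-! ### Admissibility -/

/-- `B ∈ L(U, X₋₁)` is an admissible control operator for `T`: for some `τ > 0` and all
`u ∈ L²([0, ∞); U)`, the integral `∫₀^τ T_{τ-s} B u(s) ds` (computed in `X₋₁`) lies in `X`. -/
def AdmissibleControl (T : ℝ → X →L[ℂ] X) (A : X →ₗ.[ℂ] X) (β : ℂ)
    (B : U →L[ℂ] XNeg A β) : Prop :=
  ∃ τ : ℝ, 0 < τ ∧ ∀ u : ℝ → U, MemLp u 2 (volume.restrict (Ici 0)) →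
    (∫ s in (0 : ℝ)..τ, semigroupExt A β T (τ - s) (B (u s))) ∈ range (toXNeg A β)

/-- `C ∈ L(X₁, Y)`, seen as a partially defined operator on `X` with domain `D(A)`. -/
def obsOp (A : X →ₗ.[ℂ] X) (β : ℂ) (C : XOne A β →L[ℂ] Y) : X →ₗ.[ℂ] Y where
  domain := A.domain
  toFun := (C : XOne A β →ₗ[ℂ] Y)

/-- `C ∈ L(X₁, Y)` is an admissible observation operator for `T`: for some `τ > 0` there is
`m > 0` with `∫₀^τ ‖C T_t x‖² dt ≤ m ‖x‖²` for all `x ∈ D(A)`. -/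
def AdmissibleObservation (T : ℝ → X →L[ℂ] X) (A : X →ₗ.[ℂ] X) (β : ℂ)
    (C : XOne A β →L[ℂ] Y) : Prop :=
  ∃ τ : ℝ, 0 < τ ∧ ∃ m : ℝ, 0 < m ∧ ∀ x ∈ A.domain,
    ∫ t in (0 : ℝ)..τ, ‖applyOrZero (obsOp A β C) (T t x)‖ ^ 2 ≤ m * ‖x‖ ^ 2

/-! ### The Λ-extension of an observation operator -/

/-- The operator `x ↦ C l (l I - A)⁻¹ x`, defined on all of `X`. -/
def lambdaApprox (A : X →ₗ.[ℂ] X) (β : ℂ) (C : XOne A β →L[ℂ] Y) (l : ℝ) : X →ₗ[ℂ] Y :=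
  (obsOp A β C).toFun ∘ₗ
    ((l : ℂ) • (resolvent A l).toLinearMap.codRestrict A.domain (resolvent_mem A l))

/-- The Λ-extension `C_Λ x = lim_{l → ∞} C l (l I - A)⁻¹ x` (`l` real), its domain being the
set of all `x ∈ X` for which the limit exists. -/
def lambdaExt (A : X →ₗ.[ℂ] X) (β : ℂ) (C : XOne A β →L[ℂ] Y) : X →ₗ.[ℂ] Y where
  domain :=
    { carrier := {x | ∃ y : Y, Tendsto (fun l : ℝ => lambdaApprox A β C l x) atTop (𝓝 y)}
      add_mem' := by
        rintro x x' ⟨y, hy⟩ ⟨y', hy'⟩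
        exact ⟨y + y', by simpa only [map_add] using hy.add hy'⟩
      zero_mem' := ⟨0, by simp⟩
      smul_mem' := by
        rintro c x ⟨y, hy⟩
        exact ⟨c • y, by simpa only [map_smul] using hy.const_smul c⟩ }
  toFun :=
    { toFun := fun x => Classical.choose x.2
      map_add' := fun x x' => by
        refine tendsto_nhds_unique (Classical.choose_spec (x + x').2) ?_
        simpa only [Submodule.coe_add, map_add] using
          (Classical.choose_spec x.2).add (Classical.choose_spec x'.2)
      map_smul' := fun c x => by
        refine tendsto_nhds_unique (Classical.choose_spec (c • x).2) ?_
        simpa only [Submodule.coe_smul, map_smul, RingHom.id_apply] using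
          (Classical.choose_spec x.2).const_smul c }

/-! ### Compatible system nodes -/

/-- The space `Z = D(A) + (β I - A)⁻¹ B U`. -/
def zSpace (A : X →ₗ.[ℂ] X) (β : ℂ) (B : U →L[ℂ] XNeg A β) : Set X :=
  {z | ∃ x ∈ A.domain, ∃ v : U, z = x + resolventExt A β β (B v)}

/-- The norm of `Z`: `‖z‖_Z²` is the infimum of `‖x‖₁² + ‖v‖²` over all decompositions
`z = x + (β I - A)⁻¹ B v` with `x ∈ X₁` and `v ∈ U`. -/
def zNorm (A : X →ₗ.[ℂ] X) (β : ℂ) (B : U →L[ℂ] XNeg A β) (z : X) : ℝ :=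
  √(sInf {r : ℝ | ∃ (x : A.domain) (v : U),
    z = (x : X) + resolventExt A β β (B v) ∧ r = ‖shift A β x‖ ^ 2 + ‖v‖ ^ 2})

/-- `(A, B, C, D)` is a compatible system node on `(U, X, Y)`: `A` generates a strongly
continuous semigroup on `X`, `β ∈ ρ(A)`, `B ∈ L(U, X₋₁)`, `D ∈ L(U, Y)`, and `C : D(C) → Y` is
a linear operator such that `Z ⊆ D(C)` and the restriction of `C` to `Z` is in `L(Z, Y)`. -/
structure IsCompatibleSystemNode (A : X →ₗ.[ℂ] X) (β : ℂ) (B : U →L[ℂ] XNeg A β)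
    (C : X →ₗ.[ℂ] Y) (_D : U →L[ℂ] Y) : Prop where
  generates : ∃ T : ℝ → X →L[ℂ] X, IsC0Semigroup T ∧ IsGenerator T A
  beta_mem : β ∈ resolventSet A
  z_subset : zSpace A β B ⊆ C.domain
  bounded : ∃ M : ℝ, ∀ z (hz : z ∈ C.domain), z ∈ zSpace A β B → ‖C ⟨z, hz⟩‖ ≤ M * zNorm A β B z

/-- `(x, u, y)` is a classical solution on `[0, ∞)` of `x' = A x + B u`, `y = C x + D u`. The
first equation is between elements of `X₋₁`; since `x'(t) ∈ X`, it contains the condition that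
`A x(t) + B u(t) ∈ X`, i.e. that `(x(t), u(t))` is in the domain of the system operator. -/
structure IsClassicalSolution (A : X →ₗ.[ℂ] X) (β : ℂ) (B : U →L[ℂ] XNeg A β)
    (C : X →ₗ.[ℂ] Y) (D : U →L[ℂ] Y) (x : ℝ → X) (u : ℝ → U) (y : ℝ → Y) : Prop where
  state_C1 : ContDiffOn ℝ 1 x (Ici 0)
  input_cont : ContinuousOn u (Ici 0)
  output_cont : ContinuousOn y (Ici 0)
  state_eq : ∀ t : ℝ, 0 ≤ t →
    toXNeg A β (derivWithin x (Ici 0) t) = genExt A β (x t) + B (u t)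
  output_eq : ∀ t : ℝ, 0 ≤ t → ∃ h : x t ∈ C.domain, y t = C ⟨x t, h⟩ + D (u t)

/-- Well-posedness: for every `τ > 0` there is `K > 0` such that all classical solutions satisfy
`‖x(τ)‖² + ∫₀^τ ‖y‖² ≤ K (‖x(0)‖² + ∫₀^τ ‖u‖²)`. -/
def WellPosed (A : X →ₗ.[ℂ] X) (β : ℂ) (B : U →L[ℂ] XNeg A β)
    (C : X →ₗ.[ℂ] Y) (D : U →L[ℂ] Y) : Prop :=
  ∀ τ : ℝ, 0 < τ → ∃ K : ℝ, 0 < K ∧ ∀ (x : ℝ → X) (u : ℝ → U) (y : ℝ → Y),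
    IsClassicalSolution A β B C D x u y →
      ‖x τ‖ ^ 2 + ∫ t in (0 : ℝ)..τ, ‖y t‖ ^ 2 ≤
        K * (‖x 0‖ ^ 2 + ∫ t in (0 : ℝ)..τ, ‖u t‖ ^ 2)

/-- The transfer function `G(s) v = C (s I - A)⁻¹ B v + D v`. -/
def transferFunction (A : X →ₗ.[ℂ] X) (β : ℂ) (B : U →L[ℂ] XNeg A β)
    (C : X →ₗ.[ℂ] Y) (D : U →L[ℂ] Y) (s : ℂ) (v : U) : Y :=
  applyOrZero C (resolventExt A β s (B v)) + D v

/-- An operator valued function `G` is strictly proper: `‖G(s)‖ → 0` as `Re s → ∞`, uniformly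
with respect to `Im s`. -/
def StrictlyProper (G : ℂ → U → Y) : Prop :=
  ∀ ε : ℝ, 0 < ε → ∃ α : ℝ, ∀ s : ℂ, α < s.re → ∀ v : U, ‖G s v‖ ≤ ε * ‖v‖

end General

/-! ### The diagonal generator -/

/-- The space `l²` of square summable complex sequences indexed by `k = 1, 2, 3, …`. -/
abbrev SeqSpace : Type := lp (fun _ : ℕ+ => ℂ) 2

/-- The operator `(A x)_k = i a k² x_k` with domain `{x ∈ l² | ∑ k⁴ |x_k|² < ∞}`. -/
def diagOp (a : ℝ) : SeqSpace →ₗ.[ℂ] SeqSpace where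
  domain :=
    { carrier := {x | Summable fun k : ℕ+ => (k : ℝ) ^ 4 * ‖x k‖ ^ 2}
      add_mem' := by
        intro x y hx hy
        refine Summable.of_nonneg_of_le (fun k => by positivity) (fun k => ?_)
          ((hx.add hy).mul_left 2)
        have h1 : ‖(x + y) k‖ ≤ ‖x k‖ + ‖y k‖ := norm_add_le _ _
        have h2 : ‖(x + y) k‖ ^ 2 ≤ 2 * (‖x k‖ ^ 2 + ‖y k‖ ^ 2) := by
          nlinarith [norm_nonneg ((x + y) k), sq_nonneg (‖x k‖ - ‖y k‖)]
        have h3 := mul_le_mul_of_nonneg_left h2 (by positivity : (0 : ℝ) ≤ (k : ℝ) ^ 4)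
        linarith
      zero_mem' := by simp [summable_zero]
      smul_mem' := by
        intro c x hx
        refine (hx.mul_left (‖c‖ ^ 2)).congr fun k => ?_
        simp only [lp.coeFn_smul, Pi.smul_apply, norm_smul]
        ring }
  toFun :=
    { toFun := fun x => ⟨fun k => Complex.I * a * (k : ℂ) ^ 2 * (x : SeqSpace) k, by
        refine memℓp_gen ?_
        have hx : Summable fun k : ℕ+ => (k : ℝ) ^ 4 * ‖(x : SeqSpace) k‖ ^ 2 := x.2
        refine (hx.mul_left (a ^ 2)).congr fun k => ?_
        simp only [norm_mul, Complex.norm_I, norm_pow, Complex.norm_real, Complex.norm_natCast,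
          Real.norm_eq_abs, ENNReal.toReal_ofNat, Real.rpow_two, mul_pow, sq_abs]
        ring⟩
      map_add' := fun x y => by
        ext k
        simp only [Submodule.coe_add, lp.coeFn_add, Pi.add_apply]
        ring
      map_smul' := fun c x => by
        ext k
        simp only [Submodule.coe_smul, lp.coeFn_smul, Pi.smul_apply, smul_eq_mul,
          RingHom.id_apply]
        ring }

/-- The diagonal operators `(T_t x)_k = e^{i a k² t} x_k`. -/
def diagGroup (a t : ℝ) : SeqSpace →L[ℂ] SeqSpace :=
  LinearMap.mkContinuous
    { toFun := fun x => ⟨fun k => Complex.exp (Complex.I * a * (k : ℂ) ^ 2 * t) * x k, by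
        refine memℓp_gen ((lp.memℓp x).summable (by simp) |>.congr fun k => ?_)
        have h : Complex.I * a * (k : ℂ) ^ 2 * t = ((a * (k : ℝ) ^ 2 * t : ℝ) : ℂ) * Complex.I := by
          push_cast
          ring
        rw [norm_mul, h, Complex.norm_exp_ofReal_mul_I, one_mul]⟩
      map_add' := fun x y => by
        ext k
        simp only [lp.coeFn_add, Pi.add_apply]
        ring
      map_smul' := fun c x => by
        ext k
        simp only [lp.coeFn_smul, Pi.smul_apply, smul_eq_mul, RingHom.id_apply]
        ring }
    1 fun x => by
      rw [one_mul]
      refine lp.norm_mono (by simp) fun k => ?_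
      have h : Complex.I * a * (k : ℂ) ^ 2 * t = ((a * (k : ℝ) ^ 2 * t : ℝ) : ℂ) * Complex.I := by
        push_cast
        ring
      simp only [LinearMap.coe_mk, AddHom.coe_mk]
      rw [norm_mul, h, Complex.norm_exp_ofReal_mul_I, one_mul]

/-- The `k`-th component `b_k` of `b ∈ X₋₁`: the extension by continuity of `x ↦ x_k`. -/
def component (a : ℝ) (β : ℂ) (b : XNeg (diagOp a) β) (k : ℕ+) : ℂ :=
  UniformSpace.Completion.extension
    (fun x : PreNeg (diagOp a) β => ((toPreNeg (diagOp a) β).symm x : SeqSpace) k) b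

/-- The `k`-th component `c_k = C e_k` of a functional `C` on `X₁`, where `(e_k)` is the standard
basis of `l²`. -/
def obsComponent (a : ℝ) (β : ℂ) (C : XOne (diagOp a) β →L[ℂ] ℂ) (k : ℕ+) : ℂ :=
  applyOrZero (obsOp (diagOp a) β C) (lp.single 2 k (1 : ℂ))

/-- The operator in `L(ℂ, X₋₁)` given by a vector `b ∈ X₋₁`. -/
def controlOp (a : ℝ) (β : ℂ) (b : XNeg (diagOp a) β) : ℂ →L[ℂ] XNeg (diagOp a) β :=
  ContinuousLinearMap.toSpanSingleton ℂ b

end SysNode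

end

noncomputable section

namespace SysNode

/-! Everything is diagonal with eigenvalues λ_k = i a k², and the two admissibility hypotheses serve
only to show that (b_k) and (c_k) are bounded. For C this comes from testing on e_k, since |C T_t
e_k| = |c_k| for all t (`obsComponent_bounded`). For B, the coordinates of the integral over [0, τ]
are inner products of u with functions of norm √τ |b_k|, and the uniform boundedness principle
applies (`component_bounded`).

Quadratic growth of λ_k makes ∑ 1/|s - λ_k| converge for every s in the resolvent set
(`summable_inv_sub_eigval`). Hence c_k z_k is absolutely summable for z in Z, and C_Λ z = ∑ c_k z_k
by dominated convergence (`tendsto_lambdaApprox`). This gives compatibility and G(s) = ∑ b_k c_k /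
(s - λ_k). Since √2 |s - λ_k| ≥ Re s + |Im s - a k²|, and the squares on either side of Im s / a are
at least as far from it as 0, 1, 4, 9, ..., the series is bounded by two copies of ∑ 1/(Re s / a +
k²), whatever Im s is (`tsum_inv_sub_eigval_le`).

Well-posedness rests on Parseval's identity. All e^{λ_k t} have period 2π/a, so Bessel's inequality
on a multiple of that period controls the state, and its dual controls the output of free motions.
For the forced output, the solution is damped by e^{-t} and corrected by a free motion until it is
τ-periodic; its n-th Fourier coefficient is then that of the input times a truncation of G at 1 +
2πin/τ, which is bounded uniformly in n and in the truncation. These estimates concern finitely many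
modes, and the limit is taken at the end (`wellPosed_lambdaExt`). -/

/-- The eigenvalues `i a k²` of the diagonal generator. -/
def eigval (a : ℝ) (k : ℕ+) : ℂ := Complex.I * a * (k : ℂ) ^ 2

theorem eigval_eq (a : ℝ) (k : ℕ+) : eigval a k = ((a * (k : ℝ) ^ 2 : ℝ) : ℂ) * Complex.I := by
  unfold eigval; push_cast; ring

theorem eigval_re (a : ℝ) (k : ℕ+) : (eigval a k).re = 0 := by
  rw [eigval_eq]; simp only [Complex.re_ofReal_mul, Complex.I_re, mul_zero]

theorem eigval_im (a : ℝ) (k : ℕ+) : (eigval a k).im = a * (k : ℝ) ^ 2 := by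
  rw [eigval_eq]; simp only [Complex.im_ofReal_mul, Complex.I_im, mul_one]

theorem norm_eigval {a : ℝ} (ha : 0 < a) (k : ℕ+) : ‖eigval a k‖ = a * (k : ℝ) ^ 2 := by
  rw [eigval_eq, norm_mul, Complex.norm_I, mul_one, Complex.norm_real, Real.norm_eq_abs,
    abs_of_nonneg (by positivity)]

theorem norm_exp_eigval_mul (a : ℝ) (k : ℕ+) (t : ℝ) : ‖Complex.exp (eigval a k * t)‖ = 1 := by
  rw [Complex.norm_exp]
  simp [eigval_re]

/-! ### Coordinates, multipliers and dominated convergence in l² -/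

namespace SeqSpace

theorem summable_norm_sq (x : SeqSpace) : Summable fun k => ‖x k‖ ^ 2 := by
  simpa using (lp.memℓp x).summable (by simp)

theorem norm_sq_eq_tsum (x : SeqSpace) : ‖x‖ ^ 2 = ∑' k, ‖x k‖ ^ 2 := by
  simpa using lp.norm_rpow_eq_tsum (p := 2) (by simp) x

theorem norm_apply_le (x : SeqSpace) (k : ℕ+) : ‖x k‖ ≤ ‖x‖ := lp.norm_apply_le_norm (by simp) x k

/-- The square summable sequence with the given entries. -/
def mk (f : ℕ+ → ℂ) (hf : Summable fun k => ‖f k‖ ^ 2) : SeqSpace :=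
  ⟨f, memℓp_gen (by simpa using hf)⟩

@[simp] theorem mk_apply (f : ℕ+ → ℂ) (hf : Summable fun k => ‖f k‖ ^ 2) (k : ℕ+) :
    mk f hf k = f k := rfl

theorem norm_le_of_forall_apply_le {x y : SeqSpace} {K : ℝ} (hK : 0 ≤ K)
    (h : ∀ k, ‖x k‖ ≤ K * ‖y k‖) : ‖x‖ ≤ K * ‖y‖ := by
  rw [← abs_of_nonneg (norm_nonneg x), ← abs_of_nonneg (mul_nonneg hK (norm_nonneg y)),
    ← sq_le_sq, mul_pow, norm_sq_eq_tsum, norm_sq_eq_tsum, ← tsum_mul_left]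
  refine (summable_norm_sq x).tsum_le_tsum (fun k => ?_) ((summable_norm_sq y).mul_left _)
  rw [← mul_pow]
  exact pow_le_pow_left₀ (norm_nonneg _) (h k) 2

theorem summable_mul_of_bounded {m : ℕ+ → ℂ} {K : ℝ} (hm : ∀ k, ‖m k‖ ≤ K) (x : SeqSpace) :
    Summable fun k => ‖m k * x k‖ ^ 2 := by
  refine Summable.of_nonneg_of_le (fun k => by positivity) (fun k => ?_)
    ((summable_norm_sq x).mul_left (K ^ 2))
  rw [norm_mul, mul_pow]
  gcongr
  exact hm k

/-- Multiplication by a bounded sequence. -/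
def mulCLM (m : ℕ+ → ℂ) (K : ℝ) (hm : ∀ k, ‖m k‖ ≤ K) : SeqSpace →L[ℂ] SeqSpace :=
  LinearMap.mkContinuous
    { toFun := fun x => mk (fun k => m k * x k) (summable_mul_of_bounded hm x)
      map_add' := fun x y => by
        ext k
        simp [mul_add]
      map_smul' := fun c x => by
        ext k
        simp only [mk_apply, lp.coeFn_smul, Pi.smul_apply, smul_eq_mul, RingHom.id_apply]
        ring }
    K fun x => norm_le_of_forall_apply_le ((norm_nonneg _).trans (hm 1)) fun k => by
      simp only [LinearMap.coe_mk, AddHom.coe_mk, mk_apply, norm_mul]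
      gcongr
      exact hm k

@[simp] theorem mulCLM_apply (m : ℕ+ → ℂ) (K : ℝ) (hm : ∀ k, ‖m k‖ ≤ K) (x : SeqSpace) (k : ℕ+) :
    mulCLM m K hm x k = m k * x k := rfl

/-- Dominated convergence in `l²`. -/
theorem tendsto_of_dominated {ι : Type*} {l : Filter ι} {f : ι → SeqSpace} {g : SeqSpace}
    {bound : ℕ+ → ℝ} (hb : Summable fun k => bound k ^ 2)
    (hfg : ∀ k, Tendsto (fun i => f i k) l (𝓝 (g k)))
    (hle : ∀ᶠ i in l, ∀ k, ‖f i k - g k‖ ≤ bound k) : Tendsto f l (𝓝 g) := by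
  rw [tendsto_iff_norm_sub_tendsto_zero]
  have h : Tendsto (fun i => ‖f i - g‖ ^ 2) l (𝓝 0) := by
    simp_rw [norm_sq_eq_tsum]
    rw [← tsum_zero (α := ℝ) (β := ℕ+)]
    refine tendsto_tsum_of_dominated_convergence hb (fun k => ?_) ?_
    · have := ((hfg k).sub_const (g k)).norm.pow 2
      simpa using this
    · filter_upwards [hle] with i hi k
      rw [norm_pow, norm_norm]
      exact pow_le_pow_left₀ (norm_nonneg _) (hi k) 2
  simpa [Real.sqrt_sq] using h.sqrt

end SeqSpace

/-! ### The diagonal unitary group and its generator -/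

theorem mem_diagOp_domain {a : ℝ} {x : SeqSpace} :
    x ∈ (diagOp a).domain ↔ Summable fun k : ℕ+ => (k : ℝ) ^ 4 * ‖x k‖ ^ 2 := Iff.rfl

theorem norm_eigval_mul_sq {a : ℝ} (ha : 0 < a) (k : ℕ+) (z : ℂ) :
    ‖eigval a k * z‖ ^ 2 = a ^ 2 * ((k : ℝ) ^ 4 * ‖z‖ ^ 2) := by
  rw [norm_mul, norm_eigval ha]; ring

theorem mem_diagOp_domain_iff {a : ℝ} (ha : 0 < a) {x : SeqSpace} :
    x ∈ (diagOp a).domain ↔ Summable fun k : ℕ+ => ‖eigval a k * x k‖ ^ 2 := by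
  simp_rw [norm_eigval_mul_sq ha, mem_diagOp_domain]
  rw [summable_mul_left_iff (by positivity)]

theorem diagOp_apply (a : ℝ) (x : (diagOp a).domain) (k : ℕ+) :
    diagOp a x k = eigval a k * (x : SeqSpace) k := rfl

theorem shift_diagOp_apply (a : ℝ) (β : ℂ) (x : (diagOp a).domain) (k : ℕ+) :
    shift (diagOp a) β x k = (β - eigval a k) * (x : SeqSpace) k := by
  rw [sub_mul]; rfl

theorem diagGroup_apply (a t : ℝ) (x : SeqSpace) (k : ℕ+) :
    diagGroup a t x k = Complex.exp (eigval a k * t) * x k := rfl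

theorem norm_diagGroup_apply_apply (a t : ℝ) (x : SeqSpace) (k : ℕ+) :
    ‖diagGroup a t x k‖ = ‖x k‖ := by
  rw [diagGroup_apply, norm_mul, norm_exp_eigval_mul, one_mul]

theorem norm_diagGroup (a t : ℝ) (x : SeqSpace) : ‖diagGroup a t x‖ = ‖x‖ := by
  rw [← abs_of_nonneg (norm_nonneg x), ← abs_of_nonneg (norm_nonneg (diagGroup a t x)),
    ← sq_eq_sq_iff_abs_eq_abs, SeqSpace.norm_sq_eq_tsum, SeqSpace.norm_sq_eq_tsum]
  simp_rw [norm_diagGroup_apply_apply]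

theorem diagGroup_zero (a : ℝ) : diagGroup a 0 = 1 := by
  ext x k
  simp [diagGroup_apply]

theorem diagGroup_add (a s t : ℝ) : diagGroup a (s + t) = diagGroup a s * diagGroup a t := by
  ext x k
  simp only [diagGroup_apply, mul_apply_eq_comp]
  rw [← mul_assoc, ← Complex.exp_add]
  push_cast
  ring_nf

theorem continuous_diagGroup (a : ℝ) (x : SeqSpace) : Continuous fun t => diagGroup a t x := by
  rw [continuous_iff_continuousAt]
  intro s
  refine SeqSpace.tendsto_of_dominated (bound := fun k => 2 * ‖x k‖) ?_ (fun k => ?_) ?_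
  · simp_rw [mul_pow]
    exact (SeqSpace.summable_norm_sq x).mul_left _
  · simp_rw [diagGroup_apply]
    have : Continuous fun t : ℝ => Complex.exp (eigval a k * t) * x k := by fun_prop
    exact this.tendsto s
  · refine Eventually.of_forall fun t k => (norm_sub_le _ _).trans ?_
    rw [norm_diagGroup_apply_apply, norm_diagGroup_apply_apply, two_mul]

theorem adjoint_diagGroup (a t : ℝ) : star (diagGroup a t) = diagGroup a (-t) := by
  rw [ContinuousLinearMap.star_eq_adjoint, eq_comm, ContinuousLinearMap.eq_adjoint_iff]
  intro x y
  rw [lp.inner_eq_tsum, lp.inner_eq_tsum]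
  refine tsum_congr fun k => ?_
  simp only [diagGroup_apply, RCLike.inner_apply, map_mul]
  rw [← Complex.exp_conj, map_mul, Complex.conj_ofReal, eigval_eq, map_mul, Complex.conj_I,
    Complex.conj_ofReal]
  push_cast
  ring_nf

theorem isUnitaryGroup_diagGroup (a : ℝ) : IsUnitaryGroup (diagGroup a) where
  zero := diagGroup_zero a
  add := diagGroup_add a
  cont := continuous_diagGroup a
  unitary t := by
    rw [Unitary.mem_iff, adjoint_diagGroup, ← diagGroup_add, ← diagGroup_add]
    simp [diagGroup_zero]

theorem norm_exp_eigval_sub_one_le (a : ℝ) (k : ℕ+) (t : ℝ) :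
    ‖Complex.exp (eigval a k * t) - 1‖ ≤ ‖eigval a k‖ * |t| := by
  have h : eigval a k * t = Complex.I * ((a * (k : ℝ) ^ 2 * t : ℝ) : ℂ) := by
    rw [eigval_eq]; push_cast; ring
  rw [h]
  refine (Real.norm_exp_I_mul_ofReal_sub_one_le).trans ?_
  rw [norm_mul, Real.norm_eq_abs, ← Real.norm_eq_abs (a * _), eigval_eq, norm_mul]
  simp

theorem diagGroup_quotient_apply (a t : ℝ) (x : SeqSpace) (k : ℕ+) :
    ((t : ℂ)⁻¹ • (diagGroup a t x - x)) k =
      (t : ℂ)⁻¹ * ((Complex.exp (eigval a k * t) - 1) * x k) := by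
  rw [sub_mul, one_mul]; rfl

theorem tendsto_diagGroup_quotient_apply (a : ℝ) (x : SeqSpace) (k : ℕ+) :
    Tendsto (fun t : ℝ => ((t : ℂ)⁻¹ • (diagGroup a t x - x)) k) (𝓝[>] 0)
      (𝓝 (eigval a k * x k)) := by
  have h : HasDerivAt (fun t : ℝ => Complex.exp (eigval a k * t) * x k) (eigval a k * x k) 0 := by
    have h1 : HasDerivAt (fun t : ℝ => eigval a k * (t : ℂ)) (eigval a k) 0 := by
      simpa using (Complex.ofRealCLM.hasDerivAt (x := (0 : ℝ))).const_mul (eigval a k)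
    simpa using (h1.cexp).mul_const (x k)
  have h2 := h.tendsto_slope_zero_right
  refine h2.congr fun t => ?_
  rw [diagGroup_quotient_apply]
  simp [sub_mul]

theorem isGenerator_diagGroup {a : ℝ} (ha : 0 < a) : IsGenerator (diagGroup a) (diagOp a) := by
  intro x y
  constructor
  · rintro ⟨h, rfl⟩
    have hs := (mem_diagOp_domain_iff ha).1 h
    -- Difference quotient and limit are each at most |λ_k x_k|, because |e^{iθ} - 1| ≤ |θ|.
    refine SeqSpace.tendsto_of_dominated (bound := fun k => 2 * ‖eigval a k * x k‖) ?_
      (fun k => tendsto_diagGroup_quotient_apply a x k) ?_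
    · simp_rw [mul_pow]
      exact hs.mul_left _
    · filter_upwards [self_mem_nhdsWithin] with t ht k
      have ht : 0 < t := ht
      refine (norm_sub_le _ _).trans ?_
      rw [two_mul]
      refine add_le_add ?_ le_rfl
      rw [diagGroup_quotient_apply, norm_mul, norm_mul, norm_mul, norm_inv, Complex.norm_real, Real.norm_eq_abs,
        inv_mul_le_iff₀ (by positivity)]
      have := mul_le_mul_of_nonneg_right (norm_exp_eigval_sub_one_le a k t) (norm_nonneg (x k))
      linarith
  · intro h
    -- Convergence in l² forces convergence of coordinates, so λ_k x_k = y_k; square summability of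
    -- y then puts x in the domain.
    have hy : ∀ k, eigval a k * x k = y k := fun k =>
      tendsto_nhds_unique (tendsto_diagGroup_quotient_apply a x k)
        (((lp.evalCLM ℂ (fun _ : ℕ+ => ℂ) 2 k).continuous.tendsto y).comp h)
    have hx : x ∈ (diagOp a).domain := by
      rw [mem_diagOp_domain_iff ha]
      simp_rw [hy]
      exact SeqSpace.summable_norm_sq y
    exact ⟨hx, by ext k; rw [diagOp_apply]; exact hy k⟩

/-! ### The resolvent set and the resolvent in coordinates -/

theorem single_mem_domain (a : ℝ) (k : ℕ+) (z : ℂ) : lp.single 2 k z ∈ (diagOp a).domain := by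
  rw [mem_diagOp_domain]
  refine summable_of_ne_finset_zero (s := {k}) fun j hj => ?_
  rw [lp.single_apply_ne _ _ _ (by simpa using hj)]
  simp

/-- If s = λ_k, then e_k is a nonzero vector in the kernel of sI - A. -/
theorem sub_eigval_ne_zero {a : ℝ} {s : ℂ} (hs : s ∈ resolventSet (diagOp a)) (k : ℕ+) :
    s - eigval a k ≠ 0 := by
  obtain ⟨R, -, hR⟩ := hs
  intro h
  have h0 : shift (diagOp a) s ⟨lp.single 2 k 1, single_mem_domain a k 1⟩ = 0 := by
    ext j
    rw [shift_diagOp_apply]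
    by_cases hj : j = k
    · subst hj; simp [h]
    · simp only [lp.single_apply_ne _ _ _ hj]; simp
  have h1 := hR ⟨lp.single 2 k 1, single_mem_domain a k 1⟩
  rw [h0, map_zero] at h1
  have h2 := congrArg (fun x : SeqSpace => x k) h1
  simp at h2

theorem isResolvent_resolvent {a : ℝ} {s : ℂ} (hs : s ∈ resolventSet (diagOp a)) :
    IsResolvent (diagOp a) s (resolvent (diagOp a) s) := by
  unfold resolvent
  rw [dif_pos hs]
  exact Classical.choose_spec hs

theorem resolvent_apply {a : ℝ} {s : ℂ} (hs : s ∈ resolventSet (diagOp a)) (x : SeqSpace)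
    (k : ℕ+) : resolvent (diagOp a) s x k = x k / (s - eigval a k) := by
  obtain ⟨h, hx⟩ := (isResolvent_resolvent hs).1 x
  have h1 := congrArg (fun x : SeqSpace => x k) hx
  simp only [shift_diagOp_apply] at h1
  rw [eq_div_iff (sub_eigval_ne_zero hs k), mul_comm]
  exact h1

theorem mem_resolventSet_of_bound {a : ℝ} (ha : 0 < a) {s : ℂ} {K : ℝ}
    (h0 : ∀ k, s - eigval a k ≠ 0) (hK : ∀ k, ‖(s - eigval a k)⁻¹‖ ≤ K) :
    s ∈ resolventSet (diagOp a) := by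
  refine ⟨SeqSpace.mulCLM _ K hK, fun x => ?_, fun x => ?_⟩
  · have hd : SeqSpace.mulCLM _ K hK x ∈ (diagOp a).domain := by
      rw [mem_diagOp_domain_iff ha]
      -- From λ/(s - λ) = s/(s - λ) - 1: the would-be image A R x is s R x - x, which lies in l².
      have : ∀ k, eigval a k * SeqSpace.mulCLM _ K hK x k =
          (s • SeqSpace.mulCLM _ K hK x - x) k := fun k => by
        simp only [SeqSpace.mulCLM_apply, lp.coeFn_sub, lp.coeFn_smul, Pi.sub_apply,
          Pi.smul_apply, smul_eq_mul]
        field_simp [h0 k]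
        ring
      simp_rw [this]
      exact SeqSpace.summable_norm_sq _
    refine ⟨hd, ?_⟩
    ext k
    rw [shift_diagOp_apply, SeqSpace.mulCLM_apply, mul_inv_cancel_left₀ (h0 k)]
  · ext k
    rw [SeqSpace.mulCLM_apply, shift_diagOp_apply, inv_mul_cancel_left₀ (h0 k)]

theorem re_le_norm_sub_eigval (a : ℝ) (s : ℂ) (k : ℕ+) : s.re ≤ ‖s - eigval a k‖ := by
  have := Complex.re_le_norm (s - eigval a k)
  simpa [eigval_re] using this

theorem mem_resolventSet_of_re_pos {a : ℝ} (ha : 0 < a) {s : ℂ} (hs : 0 < s.re) :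
    s ∈ resolventSet (diagOp a) := by
  have h : ∀ k, 0 < ‖s - eigval a k‖ := fun k => hs.trans_le (re_le_norm_sub_eigval a s k)
  refine mem_resolventSet_of_bound ha (K := s.re⁻¹) (fun k => norm_pos_iff.1 (h k)) fun k => ?_
  rw [norm_inv]
  exact inv_anti₀ hs (re_le_norm_sub_eigval a s k)

theorem norm_inv_sub_eigval_le {a : ℝ} {s : ℂ} (hs : s ∈ resolventSet (diagOp a)) (k : ℕ+) :
    ‖(s - eigval a k)⁻¹‖ ≤ ‖resolvent (diagOp a) s‖ := by
  have h := (SeqSpace.norm_apply_le (resolvent (diagOp a) s (lp.single 2 k 1)) k).trans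
    ((resolvent (diagOp a) s).le_opNorm _)
  rw [resolvent_apply hs, lp.norm_single (by simp)] at h
  simpa using h

/-- The growth of λ_k enters here. At s = 1 the terms are at most 1/(a k²), and the resolvent
identity compares any other s with 1 at the cost of the factor `K`. -/
theorem summable_inv_sub_eigval {a : ℝ} (ha : 0 < a) {s : ℂ}
    (hs : s ∈ resolventSet (diagOp a)) : Summable fun k => ‖(s - eigval a k)⁻¹‖ := by
  set K := 1 + ‖1 - s‖ * ‖resolvent (diagOp a) s‖
  have hsum : Summable fun k : ℕ+ => K * (a⁻¹ * (1 / (k : ℝ) ^ 2)) := by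
    refine Summable.mul_left _ (Summable.mul_left _ ?_)
    exact (Real.summable_one_div_nat_pow.2 one_lt_two).comp_injective PNat.coe_injective
  refine Summable.of_nonneg_of_le (fun k => norm_nonneg _) (fun k => ?_) hsum
  have hk : (0 : ℝ) < k := by exact_mod_cast k.pos
  have h1 : a * (k : ℝ) ^ 2 ≤ ‖1 - eigval a k‖ := by
    have := Complex.abs_im_le_norm (1 - eigval a k)
    rwa [Complex.sub_im, eigval_im, Complex.one_im, zero_sub, abs_neg,
      abs_of_nonneg (by positivity)] at this
  have h1' : 0 < ‖1 - eigval a k‖ := lt_of_lt_of_le (by positivity) h1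
  have h0 := sub_eigval_ne_zero hs k
  have h1ne : 1 - eigval a k ≠ 0 := norm_pos_iff.1 h1'
  have h2 : (s - eigval a k)⁻¹ = (1 + (1 - s) * (s - eigval a k)⁻¹) * (1 - eigval a k)⁻¹ := by
    field_simp
    ring
  rw [h2, norm_mul]
  refine mul_le_mul ?_ ?_ (norm_nonneg _) (by positivity)
  · refine (norm_add_le _ _).trans ?_
    rw [norm_one, norm_mul]
    have := norm_inv_sub_eigval_le hs k
    exact add_le_add_right (mul_le_mul_of_nonneg_left this (norm_nonneg _)) _
  · rw [norm_inv, one_div, ← mul_inv]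
    exact inv_anti₀ (by positivity) h1

/-! ### Extension by continuity to X₋₁ -/

section Extrapolation

open UniformSpace

variable {X F : Type*} [NormedAddCommGroup X] [InnerProductSpace ℂ X]
  [NormedAddCommGroup F] [NormedSpace ℂ F]

theorem applyOrZero_of_mem {Y : Type*} [NormedAddCommGroup Y] [InnerProductSpace ℂ Y]
    {f : X →ₗ.[ℂ] Y} {x : X} (h : x ∈ f.domain) :
    applyOrZero f x = f ⟨x, h⟩ := dif_pos h

theorem norm_toPreNeg (A : X →ₗ.[ℂ] X) (β : ℂ) (x : X) :
    ‖toPreNeg A β x‖ = ‖resolvent A β x‖ := rfl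

theorem norm_toXNeg (A : X →ₗ.[ℂ] X) (β : ℂ) (x : X) : ‖toXNeg A β x‖ = ‖resolvent A β x‖ := by
  rw [toXNeg, Completion.norm_coe, norm_toPreNeg]

theorem toXNeg_add (A : X →ₗ.[ℂ] X) (β : ℂ) (x y : X) :
    toXNeg A β (x + y) = toXNeg A β x + toXNeg A β y := by
  rw [toXNeg, map_add, Completion.coe_add]; rfl

theorem toXNeg_smul (A : X →ₗ.[ℂ] X) (β c : ℂ) (x : X) :
    toXNeg A β (c • x) = c • toXNeg A β x := by
  rw [toXNeg, map_smul, Completion.coe_smul]; rfl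

theorem XNeg.induction {A : X →ₗ.[ℂ] X} {β : ℂ} {p : XNeg A β → Prop} (b : XNeg A β)
    (hp : IsClosed {b | p b}) (h : ∀ x, p (toXNeg A β x)) : p b :=
  Completion.induction_on b hp fun x => h ((toPreNeg A β).symm x)

theorem uniformContinuous_of_resolvent_bound {A : X →ₗ.[ℂ] X} {β : ℂ} {L : X →ₗ[ℂ] F} {K : ℝ}
    (hL : ∀ x, ‖L x‖ ≤ K * ‖resolvent A β x‖) :
    UniformContinuous fun x : PreNeg A β => L ((toPreNeg A β).symm x) :=
  AddMonoidHomClass.uniformContinuous_of_bound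
    (L ∘ₗ (toPreNeg A β).symm.toLinearMap) K fun x => hL ((toPreNeg A β).symm x)

theorem extension_toXNeg {A : X →ₗ.[ℂ] X} {β : ℂ} {L : X →ₗ[ℂ] F} {K : ℝ}
    (hL : ∀ x, ‖L x‖ ≤ K * ‖resolvent A β x‖) (x : X) :
    Completion.extension (fun x : PreNeg A β => L ((toPreNeg A β).symm x)) (toXNeg A β x) =
      L x :=
  Completion.extension_coe (uniformContinuous_of_resolvent_bound hL) _

variable [CompleteSpace F]

/-- The continuous linear extension to `X₋₁` of a linear map bounded with respect to `‖·‖₋₁`. -/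
def extendCLM {A : X →ₗ.[ℂ] X} {β : ℂ} (L : X →ₗ[ℂ] F) (K : ℝ)
    (hL : ∀ x, ‖L x‖ ≤ K * ‖resolvent A β x‖) : XNeg A β →L[ℂ] F where
  -- Literally the extension that occurs in `component`, `resolventExt` and `semigroupExt`, so that
  -- the linear versions agree with them by `rfl`.
  toFun := Completion.extension fun x : PreNeg A β => L ((toPreNeg A β).symm x)
  map_add' b b' := by
    induction b, b' using Completion.induction_on₂ with
    | hp =>
      exact isClosed_eq (Completion.continuous_extension.comp (continuous_fst.add continuous_snd))
        ((Completion.continuous_extension.comp continuous_fst).add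
          (Completion.continuous_extension.comp continuous_snd))
    | ih x y =>
      have := uniformContinuous_of_resolvent_bound hL
      rw [← Completion.coe_add, Completion.extension_coe this, Completion.extension_coe this,
        Completion.extension_coe this, map_add, map_add]
  map_smul' c b := by
    induction b using Completion.induction_on with
    | hp =>
      exact isClosed_eq (Completion.continuous_extension.comp (continuous_const_smul c))
        (Completion.continuous_extension.const_smul c)
    | ih x =>
      have := uniformContinuous_of_resolvent_bound hL
      rw [← Completion.coe_smul, Completion.extension_coe this, Completion.extension_coe this,
        map_smul, map_smul, RingHom.id_apply]
  cont := Completion.continuous_extension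

theorem extendCLM_toXNeg {A : X →ₗ.[ℂ] X} {β : ℂ} (L : X →ₗ[ℂ] F) (K : ℝ)
    (hL : ∀ x, ‖L x‖ ≤ K * ‖resolvent A β x‖) (x : X) :
    extendCLM L K hL (toXNeg A β x) = L x := extension_toXNeg hL x

end Extrapolation

/-! ### Resolvent, group, generator and coordinates on X₋₁ -/

variable {a : ℝ} {β : ℂ}

/-- The extension of `(β I - A)⁻¹` to `X₋₁`, as a continuous linear map. -/
def negResolvent (a : ℝ) (β : ℂ) : XNeg (diagOp a) β →L[ℂ] SeqSpace :=
  extendCLM (resolvent (diagOp a) β).toLinearMap 1 fun x => by simp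

theorem negResolvent_eq (b : XNeg (diagOp a) β) :
    negResolvent a β b = resolventExt (diagOp a) β β b := rfl

theorem negResolvent_toXNeg (x : SeqSpace) :
    negResolvent a β (toXNeg (diagOp a) β x) = resolvent (diagOp a) β x :=
  extendCLM_toXNeg _ _ _ x

/-- This is the definition of ‖·‖₋₁, extended by density. It transports continuity and Cauchy
arguments from X₋₁ to l². -/
theorem isometry_negResolvent : Isometry (negResolvent a β) := by
  refine AddMonoidHomClass.isometry_of_norm _ fun b => ?_
  induction b using XNeg.induction with
  | hp => exact isClosed_eq (by fun_prop) (by fun_prop)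
  | h x => rw [negResolvent_toXNeg, norm_toXNeg]

/-- The resolvent identity (s - λ)⁻¹ = (1 + (β - s)(s - λ)⁻¹)(β - λ)⁻¹ in each coordinate. It lets
(sI - A)⁻¹ extend to X₋₁ although the norm there is built from β. -/
theorem resolvent_bound {s : ℂ} (hβ : β ∈ resolventSet (diagOp a))
    (hs : s ∈ resolventSet (diagOp a)) (x : SeqSpace) :
    ‖resolvent (diagOp a) s x‖ ≤
      (1 + ‖β - s‖ * ‖resolvent (diagOp a) s‖) * ‖resolvent (diagOp a) β x‖ := by
  refine SeqSpace.norm_le_of_forall_apply_le (by positivity) fun k => ?_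
  have h0 := sub_eigval_ne_zero hs k
  have h1 := sub_eigval_ne_zero hβ k
  have h : resolvent (diagOp a) s x k =
      (1 + (β - s) * (s - eigval a k)⁻¹) * resolvent (diagOp a) β x k := by
    rw [resolvent_apply hs, resolvent_apply hβ]
    field_simp
    ring
  rw [h, norm_mul]
  refine mul_le_mul_of_nonneg_right ((norm_add_le _ _).trans ?_) (norm_nonneg _)
  rw [norm_one, norm_mul]
  exact add_le_add_right
    (mul_le_mul_of_nonneg_left (norm_inv_sub_eigval_le hs k) (norm_nonneg _)) _

/-- The `k`-th component on `X₋₁`, as a continuous linear functional. -/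
def componentCLM (hβ : β ∈ resolventSet (diagOp a)) (k : ℕ+) : XNeg (diagOp a) β →L[ℂ] ℂ :=
  extendCLM (lp.evalCLM ℂ (fun _ : ℕ+ => ℂ) 2 k).toLinearMap ‖β - eigval a k‖ fun x => by
    have h : x k = (β - eigval a k) * resolvent (diagOp a) β x k := by
      rw [resolvent_apply hβ, mul_div_cancel₀ _ (sub_eigval_ne_zero hβ k)]
    change ‖x k‖ ≤ _
    rw [h, norm_mul]
    exact mul_le_mul_of_nonneg_left (SeqSpace.norm_apply_le _ _) (norm_nonneg _)

theorem componentCLM_apply (hβ : β ∈ resolventSet (diagOp a)) (k : ℕ+) (b : XNeg (diagOp a) β) :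
    componentCLM hβ k b = component a β b k := rfl

theorem componentCLM_toXNeg (hβ : β ∈ resolventSet (diagOp a)) (k : ℕ+) (x : SeqSpace) :
    componentCLM hβ k (toXNeg (diagOp a) β x) = x k :=
  extendCLM_toXNeg _ _ _ x

theorem continuous_resolventExt {s : ℂ} : Continuous (resolventExt (diagOp a) β s) :=
  UniformSpace.Completion.continuous_extension

theorem resolventExt_apply (hβ : β ∈ resolventSet (diagOp a)) {s : ℂ}
    (hs : s ∈ resolventSet (diagOp a)) (b : XNeg (diagOp a) β) (k : ℕ+) :
    resolventExt (diagOp a) β s b k = component a β b k / (s - eigval a k) := by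
  rw [← componentCLM_apply hβ]
  induction b using XNeg.induction with
  | hp =>
    refine isClosed_eq ?_ (by fun_prop)
    exact (lp.evalCLM ℂ (fun _ : ℕ+ => ℂ) 2 k).continuous.comp continuous_resolventExt
  | h x =>
    rw [componentCLM_toXNeg, ← resolvent_apply hs]
    refine congrArg (fun y : SeqSpace => y k) ?_
    exact extension_toXNeg (L := (resolvent (diagOp a) s).toLinearMap) (resolvent_bound hβ hs) x

theorem resolvent_diagGroup (hβ : β ∈ resolventSet (diagOp a)) (t : ℝ) (x : SeqSpace) :
    resolvent (diagOp a) β (diagGroup a t x) = diagGroup a t (resolvent (diagOp a) β x) := by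
  ext k
  rw [resolvent_apply hβ, diagGroup_apply, diagGroup_apply, resolvent_apply hβ, mul_div_assoc]

/-- The linear map underlying `toXNeg`. -/
def toXNegₗ (a : ℝ) (β : ℂ) : SeqSpace →ₗ[ℂ] XNeg (diagOp a) β where
  toFun := toXNeg (diagOp a) β
  map_add' := toXNeg_add _ _
  map_smul' := toXNeg_smul _ _

/-- The extension of `T t` to `X₋₁`, as a continuous linear map. -/
def semigroupExtCLM (hβ : β ∈ resolventSet (diagOp a)) (t : ℝ) :
    XNeg (diagOp a) β →L[ℂ] XNeg (diagOp a) β :=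
  extendCLM (toXNegₗ a β ∘ₗ (diagGroup a t).toLinearMap) 1 fun x => by
    change ‖toXNeg (diagOp a) β (diagGroup a t x)‖ ≤ _
    rw [norm_toXNeg, resolvent_diagGroup hβ, norm_diagGroup, one_mul]

theorem semigroupExtCLM_apply (hβ : β ∈ resolventSet (diagOp a)) (t : ℝ) (b : XNeg (diagOp a) β) :
    semigroupExtCLM hβ t b = semigroupExt (diagOp a) β (diagGroup a) t b := rfl

theorem semigroupExtCLM_toXNeg (hβ : β ∈ resolventSet (diagOp a)) (t : ℝ) (x : SeqSpace) :
    semigroupExtCLM hβ t (toXNeg (diagOp a) β x) = toXNeg (diagOp a) β (diagGroup a t x) :=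
  extendCLM_toXNeg _ _ _ x

theorem negResolvent_semigroupExtCLM (hβ : β ∈ resolventSet (diagOp a)) (t : ℝ)
    (b : XNeg (diagOp a) β) :
    negResolvent a β (semigroupExtCLM hβ t b) = diagGroup a t (negResolvent a β b) := by
  induction b using XNeg.induction with
  | hp => exact isClosed_eq (by fun_prop) (by fun_prop)
  | h x => rw [semigroupExtCLM_toXNeg, negResolvent_toXNeg, negResolvent_toXNeg,
      resolvent_diagGroup hβ]

theorem componentCLM_semigroupExtCLM (hβ : β ∈ resolventSet (diagOp a)) (t : ℝ)
    (b : XNeg (diagOp a) β) (k : ℕ+) :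
    componentCLM hβ k (semigroupExtCLM hβ t b) =
      Complex.exp (eigval a k * t) * component a β b k := by
  rw [← componentCLM_apply hβ]
  induction b using XNeg.induction with
  | hp => exact isClosed_eq (by fun_prop) (by fun_prop)
  | h x => rw [semigroupExtCLM_toXNeg, componentCLM_toXNeg, componentCLM_toXNeg, diagGroup_apply]

theorem continuous_semigroupExtCLM (hβ : β ∈ resolventSet (diagOp a)) (b : XNeg (diagOp a) β) :
    Continuous fun t => semigroupExtCLM hβ t b := by
  rw [(isometry_negResolvent (a := a) (β := β)).isEmbedding.continuous_iff]
  simp only [Function.comp_def, negResolvent_semigroupExtCLM]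
  exact continuous_diagGroup a _

theorem dense_diagOp_domain (a : ℝ) : Dense ((diagOp a).domain : Set SeqSpace) := by
  intro x
  refine mem_closure_of_tendsto (lp.hasSum_single (by simp) x) (Eventually.of_forall fun S => ?_)
  exact Submodule.sum_mem _ fun k _ => single_mem_domain a k _

/-- `extendFrom` is meaningful only where the limit exists. Under the isometry (βI - A)⁻¹ the vector
Az becomes β(βI - A)⁻¹z - z, which is continuous in z on all of l²; so the values are Cauchy along
the domain, and X₋₁ is complete. -/
theorem tendsto_genExt (hβ : β ∈ resolventSet (diagOp a)) (x : SeqSpace) :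
    Tendsto (fun x => toXNeg (diagOp a) β (applyOrZero (diagOp a) x))
      (𝓝[(diagOp a).domain] x) (𝓝 (genExt (diagOp a) β x)) := by
  refine tendsto_extendFrom ?_
  have hne : (𝓝[((diagOp a).domain : Set SeqSpace)] x).NeBot :=
    mem_closure_iff_nhdsWithin_neBot.1 (dense_diagOp_domain a x)
  refine cauchy_map_iff_exists_tendsto.1 ?_
  refine ((isometry_negResolvent (a := a) (β := β)).isUniformInducing.cauchy_map_iff).1 ?_
  rw [Filter.map_map]
  refine Tendsto.cauchy_map (a := β • resolvent (diagOp a) β x - x) ?_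
  have hc : Continuous fun x => β • resolvent (diagOp a) β x - x := by fun_prop
  refine (hc.continuousWithinAt (x := x) (s := (diagOp a).domain)).tendsto.congr' ?_
  filter_upwards [self_mem_nhdsWithin] with z hz
  rw [Function.comp_apply, negResolvent_toXNeg, applyOrZero_of_mem hz]
  ext k
  rw [resolvent_apply hβ, diagOp_apply, eq_div_iff (sub_eigval_ne_zero hβ k)]
  simp only [lp.coeFn_sub, lp.coeFn_smul, Pi.sub_apply, Pi.smul_apply, smul_eq_mul,
    resolvent_apply hβ]
  field_simp [sub_eigval_ne_zero hβ k]
  ring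

theorem componentCLM_genExt (hβ : β ∈ resolventSet (diagOp a)) (x : SeqSpace) (k : ℕ+) :
    componentCLM hβ k (genExt (diagOp a) β x) = eigval a k * x k := by
  have hne : (𝓝[((diagOp a).domain : Set SeqSpace)] x).NeBot :=
    mem_closure_iff_nhdsWithin_neBot.1 (dense_diagOp_domain a x)
  have h := ((componentCLM hβ k).continuous.tendsto _).comp (tendsto_genExt hβ x)
  refine tendsto_nhds_unique h ?_
  have hc : Continuous fun x : SeqSpace => eigval a k * x k :=
    continuous_const.mul (lp.evalCLM ℂ (fun _ : ℕ+ => ℂ) 2 k).continuous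
  refine (hc.continuousWithinAt (x := x) (s := (diagOp a).domain)).tendsto.congr' ?_
  filter_upwards [self_mem_nhdsWithin] with z hz
  rw [Function.comp_apply, componentCLM_toXNeg, applyOrZero_of_mem hz, diagOp_apply]

/-! ### Admissibility bounds the components of C and B -/

/-- The functional `x ↦ C (β I - A)⁻¹ x` on `X`. -/
def obsResolvent (hβ : β ∈ resolventSet (diagOp a)) (C : XOne (diagOp a) β →L[ℂ] ℂ) :
    SeqSpace →L[ℂ] ℂ :=
  LinearMap.mkContinuous ((obsOp (diagOp a) β C).toFun ∘ₗ
    (resolvent (diagOp a) β).toLinearMap.codRestrict (diagOp a).domain (resolvent_mem _ β)) ‖C‖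
    fun x => by
      refine (C.le_opNorm _).trans_eq ?_
      congr 1
      change ‖shift (diagOp a) β ⟨resolvent (diagOp a) β x, _⟩‖ = _
      obtain ⟨h, hx⟩ := (isResolvent_resolvent hβ).1 x
      rw [hx]

theorem obsResolvent_shift (hβ : β ∈ resolventSet (diagOp a)) (C : XOne (diagOp a) β →L[ℂ] ℂ)
    (z : (diagOp a).domain) :
    obsResolvent hβ C (shift (diagOp a) β z) = (obsOp (diagOp a) β C).toFun z := by
  change (obsOp (diagOp a) β C).toFun ⟨resolvent (diagOp a) β (shift (diagOp a) β z), _⟩ = _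
  congr 1
  exact Subtype.ext ((isResolvent_resolvent hβ).2 z)

theorem norm_obsOp_le (hβ : β ∈ resolventSet (diagOp a)) (C : XOne (diagOp a) β →L[ℂ] ℂ)
    (z : (diagOp a).domain) :
    ‖(obsOp (diagOp a) β C).toFun z‖ ≤ ‖obsResolvent hβ C‖ * ‖shift (diagOp a) β z‖ := by
  rw [← obsResolvent_shift hβ]
  exact (obsResolvent hβ C).le_opNorm _

theorem shift_single (a : ℝ) (β : ℂ) (k : ℕ+) (z : ℂ) :
    shift (diagOp a) β ⟨lp.single 2 k z, single_mem_domain a k z⟩ =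
      lp.single 2 k ((β - eigval a k) * z) := by
  ext j
  rw [shift_diagOp_apply]
  by_cases hj : j = k
  · subst hj; simp
  · simp only [lp.single_apply_ne _ _ _ hj]; simp

theorem obsComponent_eq (hβ : β ∈ resolventSet (diagOp a)) (C : XOne (diagOp a) β →L[ℂ] ℂ)
    (k : ℕ+) :
    obsComponent a β C k = obsResolvent hβ C (lp.single 2 k (β - eigval a k)) := by
  have h : lp.single 2 k (1 : ℂ) ∈ (obsOp (diagOp a) β C).domain := single_mem_domain a k 1
  rw [obsComponent, applyOrZero_of_mem h]
  refine (obsResolvent_shift hβ C ⟨_, h⟩).symm.trans ?_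
  rw [shift_single, mul_one]

/-- A functional on `X₁` is given by its components. -/
theorem hasSum_obsComponent (hβ : β ∈ resolventSet (diagOp a)) (C : XOne (diagOp a) β →L[ℂ] ℂ)
    (z : (diagOp a).domain) :
    HasSum (fun k => obsComponent a β C k * (z : SeqSpace) k)
      ((obsOp (diagOp a) β C).toFun z) := by
  -- (βI - A)z is expanded in the basis of l², where C(βI - A)⁻¹ is a bounded functional.
  have h := (obsResolvent hβ C).hasSum (lp.hasSum_single (by simp) (shift (diagOp a) β z))
  rw [obsResolvent_shift] at h
  refine h.congr_fun fun k => ?_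
  have h1 : (β - eigval a k) * (z : SeqSpace) k = (z : SeqSpace) k • (β - eigval a k) := by
    rw [smul_eq_mul, mul_comm]
  rw [obsComponent_eq hβ, shift_diagOp_apply, h1, lp.single_smul, map_smul, smul_eq_mul, mul_comm]

/-- As T_t e_k = e^{λ_k t} e_k, the integrand in the admissibility inequality is constantly |c_k|²,
so τ |c_k|² ≤ m. -/
theorem obsComponent_bounded (hβ : β ∈ resolventSet (diagOp a))
    {C : XOne (diagOp a) β →L[ℂ] ℂ}
    (hC : AdmissibleObservation (diagGroup a) (diagOp a) β C) :
    ∃ M : ℝ, 0 ≤ M ∧ ∀ k, ‖obsComponent a β C k‖ ≤ M := by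
  obtain ⟨τ, hτ, m, hm, h⟩ := hC
  refine ⟨√(m / τ), Real.sqrt_nonneg _, fun k => Real.le_sqrt_of_sq_le ?_⟩
  have h1 := h _ (single_mem_domain a k 1)
  have h2 : ∀ t : ℝ, ‖applyOrZero (obsOp (diagOp a) β C) (diagGroup a t (lp.single 2 k 1))‖ =
      ‖obsComponent a β C k‖ := fun t => by
    have h3 : diagGroup a t (lp.single 2 k 1) = lp.single 2 k (Complex.exp (eigval a k * t)) := by
      ext j
      rw [diagGroup_apply]
      by_cases hj : j = k
      · subst hj; simp
      · simp only [lp.single_apply_ne _ _ _ hj]; simp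
    have h4 : lp.single 2 k (Complex.exp (eigval a k * t)) ∈ (obsOp (diagOp a) β C).domain :=
      single_mem_domain a k _
    rw [h3, applyOrZero_of_mem h4]
    have h5 := hasSum_obsComponent hβ C ⟨_, h4⟩
    have h6 := hasSum_single (f := fun j => obsComponent a β C j *
      (lp.single 2 k (Complex.exp (eigval a k * t)) : SeqSpace) j) k fun j hj => by
        simp only [lp.single_apply_ne _ _ _ hj]; simp
    have h7 := h5.unique h6
    refine (congrArg norm h7).trans ?_
    rw [lp.single_apply_self, norm_mul, norm_exp_eigval_mul, mul_one]
  simp_rw [h2] at h1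
  rw [lp.norm_single (by simp)] at h1
  rw [le_div_iff₀ hτ]
  simpa [mul_comm] using h1

theorem component_smul (hβ : β ∈ resolventSet (diagOp a)) (b : XNeg (diagOp a) β) (v : ℂ)
    (k : ℕ+) : component a β (v • b) k = v * component a β b k := by
  rw [← componentCLM_apply hβ, map_smul, smul_eq_mul, componentCLM_apply]

/-- Admissibility gives, for each single u, a vector of l² whose k-th coordinate is a bounded
functional of u with norm √τ |b_k|. Coordinates of one vector are bounded in k, and Banach–Steinhaus
makes the bound uniform over u. -/
theorem component_bounded (hβ : β ∈ resolventSet (diagOp a)) {b : XNeg (diagOp a) β}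
    (hb : AdmissibleControl (diagGroup a) (diagOp a) β (controlOp a β b)) :
    ∃ M : ℝ, 0 ≤ M ∧ ∀ k, ‖component a β b k‖ ≤ M := by
  obtain ⟨τ, hτ, h⟩ := hb
  set μ : Measure ℝ := volume.restrict (Ici 0) with hμ
  have hIoc : (volume.restrict (Ioc 0 τ)) ≤ μ :=
    Measure.restrict_mono (fun t ht => ht.1.le) le_rfl
  have hμI : μ.restrict (Ioc 0 τ) = volume.restrict (Ioc 0 τ) := by
    rw [hμ, Measure.restrict_restrict measurableSet_Ioc, inter_eq_self_of_subset_left]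
    exact fun t ht => ht.1.le
  -- The Riesz representer of the k-th coordinate functional; conjugated because the inner product
  -- is conjugate linear in its first argument.
  let g : ℕ+ → ℝ → ℂ := fun k s => star (Complex.exp (eigval a k * (τ - s : ℝ)) * component a β b k)
  have hgc : ∀ k, Continuous (g k) := fun k => by
    have : Continuous fun s : ℝ => Complex.exp (eigval a k * (τ - s : ℝ)) * component a β b k := by
      fun_prop
    exact this.star
  have hgn : ∀ k s, ‖g k s‖ = ‖component a β b k‖ := fun k s => by
    rw [norm_star, norm_mul, norm_exp_eigval_mul, one_mul]
  have hg : ∀ k, MemLp ((Ioc 0 τ).indicator (g k)) 2 μ := fun k => by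
    rw [memLp_indicator_iff_restrict measurableSet_Ioc, hμI]
    exact MemLp.of_bound (hgc k).aestronglyMeasurable ‖component a β b k‖
      (Eventually.of_forall fun s => (hgn k s).le)
  have hbdd : ∀ u : Lp ℂ 2 μ, ∃ K, ∀ k, ‖innerSL ℂ ((hg k).toLp) u‖ ≤ K := fun u => by
    obtain ⟨w, hw⟩ := h u (Lp.memLp u)
    refine ⟨‖w‖, fun k => (le_of_eq ?_).trans (SeqSpace.norm_apply_le w k)⟩
    congr 1
    have hu : IntegrableOn (fun s => u s) (Ioc 0 τ) := by
      have := (Lp.memLp u).mono_measure hIoc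
      exact (this.mono_exponent (p := 1) (by norm_num)).integrable le_rfl
    have hF : IntervalIntegrable (fun s => semigroupExt (diagOp a) β (diagGroup a) (τ - s)
        (controlOp a β b (u s))) volume 0 τ := by
      rw [intervalIntegrable_iff_integrableOn_Ioc_of_le hτ.le]
      have : (fun s => semigroupExt (diagOp a) β (diagGroup a) (τ - s)
        (controlOp a β b (u s))) = fun s => u s • semigroupExtCLM hβ (τ - s) b := by
        ext1 s
        rw [← semigroupExtCLM_apply hβ, controlOp, ContinuousLinearMap.toSpanSingleton_apply,
          map_smul]
      rw [this]
      have hc : Continuous fun s => semigroupExtCLM hβ (τ - s) b :=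
        (continuous_semigroupExtCLM hβ b).comp (by fun_prop)
      have hn : ∀ s, ‖semigroupExtCLM hβ (τ - s) b‖ = ‖negResolvent a β b‖ := fun s => by
        rw [← (AddMonoidHomClass.isometry_iff_norm _).1 (isometry_negResolvent (a := a) (β := β)),
          negResolvent_semigroupExtCLM, norm_diagGroup]
      exact hu.smul_bdd (C := ‖negResolvent a β b‖) hc.aestronglyMeasurable
        (Eventually.of_forall fun s => (hn s).le)
    have h1 := (componentCLM hβ k).intervalIntegral_comp_comm hF
    rw [← hw, componentCLM_toXNeg] at h1
    rw [← h1, innerSL_apply_apply, L2.inner_def,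
      intervalIntegral.integral_of_le hτ.le, ← hμI, ← integral_indicator measurableSet_Ioc]
    refine integral_congr_ae ?_
    filter_upwards [(hg k).coeFn_toLp] with s hs
    rw [hs]
    by_cases hsI : s ∈ Ioc 0 τ
    · rw [indicator_of_mem hsI, indicator_of_mem hsI, ← semigroupExtCLM_apply hβ,
        componentCLM_semigroupExtCLM, controlOp, ContinuousLinearMap.toSpanSingleton_apply,
        component_smul hβ]
      simp only [g, RCLike.inner_apply, RCLike.star_def, RCLike.conj_conj]
      ring
    · rw [indicator_of_notMem hsI, indicator_of_notMem hsI, inner_zero_left]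
  obtain ⟨K, hK⟩ := banach_steinhaus hbdd
  have hnorm : ∀ k, ‖(hg k).toLp‖ ^ 2 = τ * ‖component a β b k‖ ^ 2 := fun k => by
    rw [← inner_self_eq_norm_sq (𝕜 := ℂ), L2.inner_def]
    have : ∫ s, inner ℂ ((hg k).toLp _ s) ((hg k).toLp _ s) ∂μ =
        ∫ s in Ioc 0 τ, ((‖component a β b k‖ ^ 2 : ℝ) : ℂ) := by
      rw [← hμI, ← integral_indicator measurableSet_Ioc]
      refine integral_congr_ae ?_
      filter_upwards [(hg k).coeFn_toLp] with s hs
      rw [hs]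
      by_cases hsI : s ∈ Ioc 0 τ
      · rw [indicator_of_mem hsI, indicator_of_mem hsI, inner_self_eq_norm_sq_to_K, hgn]
        push_cast; rfl
      · rw [indicator_of_notMem hsI, indicator_of_notMem hsI, inner_zero_left]
    rw [this, integral_const]
    simp [hτ.le]
    norm_cast
    exact Or.inl rfl
  refine ⟨√(K ^ 2 / τ), Real.sqrt_nonneg _, fun k => Real.le_sqrt_of_sq_le ?_⟩
  rw [le_div_iff₀ hτ, mul_comm, ← hnorm]
  have := hK k
  rw [innerSL_apply_norm] at this
  exact pow_le_pow_left₀ (norm_nonneg _) this 2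

/-! ### The Λ-extension as a series, and compatibility -/

theorem lambdaApprox_eq_tsum (ha : 0 < a) (hβ : β ∈ resolventSet (diagOp a))
    (C : XOne (diagOp a) β →L[ℂ] ℂ) {l : ℝ} (hl : 0 < l) (x : SeqSpace) :
    lambdaApprox (diagOp a) β C l x =
      ∑' k, l / (l - eigval a k) * (obsComponent a β C k * x k) := by
  have hl' : (l : ℂ) ∈ resolventSet (diagOp a) :=
    mem_resolventSet_of_re_pos ha (by simpa using hl)
  refine (hasSum_obsComponent hβ C _).tsum_eq.symm.trans (tsum_congr fun k => ?_)
  change obsComponent a β C k * ((l : ℂ) * resolvent (diagOp a) l x k) = _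
  rw [resolvent_apply hl']
  ring

/-- The multipliers l/(l - λ_k) tend to 1 and have modulus at most 1, as λ_k is imaginary; the
series itself is the majorant. -/
theorem tendsto_lambdaApprox (ha : 0 < a) (hβ : β ∈ resolventSet (diagOp a))
    {C : XOne (diagOp a) β →L[ℂ] ℂ} {x : SeqSpace}
    (hx : Summable fun k => ‖obsComponent a β C k * x k‖) :
    Tendsto (fun l : ℝ => lambdaApprox (diagOp a) β C l x) atTop
      (𝓝 (∑' k, obsComponent a β C k * x k)) := by
  have h : Tendsto (fun l : ℝ => ∑' k, (l : ℂ) / (l - eigval a k) * (obsComponent a β C k * x k))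
      atTop (𝓝 (∑' k, obsComponent a β C k * x k)) := by
    refine tendsto_tsum_of_dominated_convergence hx (fun k => ?_) ?_
    · have h1 : Tendsto (fun l : ℝ => (1 - eigval a k * (l : ℂ)⁻¹)⁻¹) atTop (𝓝 1) := by
        have h2 : Tendsto (fun l : ℝ => (l : ℂ)⁻¹) atTop (𝓝 0) := by
          have := (Complex.continuous_ofReal.tendsto 0).comp tendsto_inv_atTop_zero
          simpa [Function.comp_def] using this
        have h3 := ((h2.const_mul (eigval a k)).const_sub 1).inv₀ (by simp)
        simpa using h3
      have h4 := h1.mul_const (obsComponent a β C k * x k)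
      rw [one_mul] at h4
      refine h4.congr' ?_
      filter_upwards [eventually_gt_atTop 0] with l hl
      have hl0 : (l : ℂ) ≠ 0 := by exact_mod_cast hl.ne'
      congr 1
      rw [← one_div, ← mul_div_mul_left _ _ hl0, mul_sub, mul_one, mul_left_comm,
        mul_inv_cancel₀ hl0, mul_one]
    · filter_upwards [eventually_gt_atTop 0] with l hl k
      rw [norm_mul]
      refine mul_le_of_le_one_left (norm_nonneg _) ?_
      have := re_le_norm_sub_eigval a l k
      rw [Complex.ofReal_re] at this
      rw [norm_div, Complex.norm_real, Real.norm_eq_abs, abs_of_pos hl]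
      exact div_le_one_of_le₀ this (norm_nonneg _)
  refine h.congr' ?_
  filter_upwards [eventually_gt_atTop 0] with l hl
  exact (lambdaApprox_eq_tsum ha hβ C hl x).symm

theorem mem_lambdaExt_domain (ha : 0 < a) (hβ : β ∈ resolventSet (diagOp a))
    {C : XOne (diagOp a) β →L[ℂ] ℂ} {x : SeqSpace}
    (hx : Summable fun k => ‖obsComponent a β C k * x k‖) :
    x ∈ (lambdaExt (diagOp a) β C).domain :=
  ⟨_, tendsto_lambdaApprox ha hβ hx⟩

theorem lambdaExt_apply (ha : 0 < a) (hβ : β ∈ resolventSet (diagOp a))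
    {C : XOne (diagOp a) β →L[ℂ] ℂ} {x : SeqSpace}
    (hx : Summable fun k => ‖obsComponent a β C k * x k‖)
    (h : x ∈ (lambdaExt (diagOp a) β C).domain) :
    lambdaExt (diagOp a) β C ⟨x, h⟩ = ∑' k, obsComponent a β C k * x k :=
  tendsto_nhds_unique (Classical.choose_spec h) (tendsto_lambdaApprox ha hβ hx)

theorem summable_mul_inv_sub_eigval (ha : 0 < a) {s : ℂ} (hs : s ∈ resolventSet (diagOp a))
    {m : ℕ+ → ℂ} {M : ℝ} (hm : ∀ k, ‖m k‖ ≤ M) : Summable fun k => ‖m k / (s - eigval a k)‖ := by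
  refine Summable.of_nonneg_of_le (fun k => norm_nonneg _) (fun k => ?_)
    ((summable_inv_sub_eigval ha hs).mul_left M)
  rw [div_eq_mul_inv, norm_mul]
  gcongr
  exact hm k

theorem summable_obsComponent_mul (ha : 0 < a) {s : ℂ} (hs : s ∈ resolventSet (diagOp a))
    {c m : ℕ+ → ℂ} {M M' : ℝ} (hc : ∀ k, ‖c k‖ ≤ M) (hm : ∀ k, ‖m k‖ ≤ M') :
    Summable fun k => ‖c k * (m k / (s - eigval a k))‖ := by
  simp_rw [← mul_div_assoc]
  refine summable_mul_inv_sub_eigval ha hs (M := M * M') fun k => ?_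
  rw [norm_mul]
  exact mul_le_mul (hc k) (hm k) (norm_nonneg _) ((norm_nonneg _).trans (hc k))

theorem applyOrZero_lambdaExt_resolventExt (ha : 0 < a) (hβ : β ∈ resolventSet (diagOp a))
    {s : ℂ} (hs : s ∈ resolventSet (diagOp a)) {b : XNeg (diagOp a) β}
    {C : XOne (diagOp a) β →L[ℂ] ℂ} {M M' : ℝ} (hb : ∀ k, ‖component a β b k‖ ≤ M)
    (hc : ∀ k, ‖obsComponent a β C k‖ ≤ M') :
    applyOrZero (lambdaExt (diagOp a) β C) (resolventExt (diagOp a) β s b) =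
      ∑' k, obsComponent a β C k * (component a β b k / (s - eigval a k)) := by
  have hx : Summable fun k => ‖obsComponent a β C k * resolventExt (diagOp a) β s b k‖ := by
    simp_rw [resolventExt_apply hβ hs]
    exact summable_obsComponent_mul ha hs hc hb
  rw [applyOrZero_of_mem (mem_lambdaExt_domain ha hβ hx), lambdaExt_apply ha hβ hx]
  simp_rw [resolventExt_apply hβ hs]

/-- The coordinates of x are those of the l² vector (βI - A)x, a bounded sequence, divided by β -
λ_k. -/
theorem summable_obsComponent_domain (ha : 0 < a) (hβ : β ∈ resolventSet (diagOp a))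
    {C : XOne (diagOp a) β →L[ℂ] ℂ} {M : ℝ} (hc : ∀ k, ‖obsComponent a β C k‖ ≤ M)
    {x : SeqSpace} (hx : x ∈ (diagOp a).domain) :
    Summable fun k => ‖obsComponent a β C k * x k‖ := by
  have h : ∀ k, x k = shift (diagOp a) β ⟨x, hx⟩ k / (β - eigval a k) := fun k => by
    rw [shift_diagOp_apply, mul_div_cancel_left₀ _ (sub_eigval_ne_zero hβ k)]
  refine (summable_obsComponent_mul ha hβ hc
    (SeqSpace.norm_apply_le (shift (diagOp a) β ⟨x, hx⟩))).congr fun k => ?_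
  rw [← h]

theorem isC0Semigroup_diagGroup (a : ℝ) : IsC0Semigroup (diagGroup a) where
  zero := diagGroup_zero a
  add s t _ _ := diagGroup_add a s t
  cont x := (continuous_diagGroup a x).continuousOn

theorem isCompatibleSystemNode_lambdaExt (ha : 0 < a) (hβ : β ∈ resolventSet (diagOp a))
    {b : XNeg (diagOp a) β} {C : XOne (diagOp a) β →L[ℂ] ℂ} {M M' : ℝ}
    (hb : ∀ k, ‖component a β b k‖ ≤ M) (hc : ∀ k, ‖obsComponent a β C k‖ ≤ M') :
    IsCompatibleSystemNode (diagOp a) β (controlOp a β b) (lambdaExt (diagOp a) β C) 0 := by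
  have hB : ∀ v : ℂ, resolventExt (diagOp a) β β (controlOp a β b v) =
      v • resolventExt (diagOp a) β β b := fun v => by
    rw [controlOp, ContinuousLinearMap.toSpanSingleton_apply, ← negResolvent_eq, map_smul]
    rfl
  have hR : Summable fun k => ‖obsComponent a β C k * resolventExt (diagOp a) β β b k‖ := by
    simp_rw [resolventExt_apply hβ hβ]
    exact summable_obsComponent_mul ha hβ hc hb
  have hRm := mem_lambdaExt_domain ha hβ hR
  have hdom : ∀ x ∈ (diagOp a).domain, x ∈ (lambdaExt (diagOp a) β C).domain := fun x hx =>
    mem_lambdaExt_domain ha hβ (summable_obsComponent_domain ha hβ hc hx)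
  refine ⟨⟨_, isC0Semigroup_diagGroup a, isGenerator_diagGroup ha⟩, hβ, ?_, ?_⟩
  · rintro z ⟨x, hx, v, rfl⟩
    rw [hB]
    exact Submodule.add_mem _ (hdom x hx) (Submodule.smul_mem _ _ hRm)
  · set p := ‖obsResolvent hβ C‖
    set q := ‖lambdaExt (diagOp a) β C ⟨_, hRm⟩‖
    -- Cauchy–Schwarz gives the constant √(p² + q²) for each decomposition of z; 1 + p + q exceeds
    -- it and is positive, so one may divide by it before passing to the infimum.
    refine ⟨1 + p + q, fun z hz hzZ => ?_⟩
    have hK : 0 < 1 + p + q := by positivity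
    rw [← div_le_iff₀' hK]
    refine Real.le_sqrt_of_sq_le (le_csInf ?_ ?_)
    · obtain ⟨x, hx, v, h⟩ := hzZ
      exact ⟨_, ⟨x, hx⟩, v, h, rfl⟩
    · rintro r ⟨x, v, h, rfl⟩
      have hxd := hdom x x.2
      have h1 : lambdaExt (diagOp a) β C ⟨z, hz⟩ =
          lambdaExt (diagOp a) β C ⟨x, hxd⟩ + v • lambdaExt (diagOp a) β C ⟨_, hRm⟩ := by
        rw [← LinearPMap.map_smul, ← LinearPMap.map_add]
        congr 1
        exact Subtype.ext (h.trans (by rw [hB]; rfl))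
      have h2 : ‖lambdaExt (diagOp a) β C ⟨x, hxd⟩‖ ≤ p * ‖shift (diagOp a) β x‖ := by
        rw [lambdaExt_apply ha hβ (summable_obsComponent_domain ha hβ hc x.2),
          (hasSum_obsComponent hβ C x).tsum_eq]
        exact norm_obsOp_le hβ C x
      have h3 : ‖lambdaExt (diagOp a) β C ⟨z, hz⟩‖ ≤ p * ‖shift (diagOp a) β x‖ + ‖v‖ * q := by
        rw [h1]
        refine (norm_add_le _ _).trans ?_
        rw [norm_smul]
        exact add_le_add_left h2 _
      rw [div_pow, div_le_iff₀ (by positivity)]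
      set n := ‖shift (diagOp a) β x‖
      have hn : 0 ≤ n := norm_nonneg _
      have hp : 0 ≤ p := norm_nonneg _
      have hq : 0 ≤ q := norm_nonneg _
      have hv : 0 ≤ ‖v‖ := norm_nonneg _
      calc _ ≤ (p * n + ‖v‖ * q) ^ 2 := pow_le_pow_left₀ (norm_nonneg _) h3 2
        _ ≤ (n ^ 2 + ‖v‖ ^ 2) * (p ^ 2 + q ^ 2) := by nlinarith [sq_nonneg (n * q - p * ‖v‖)]
        _ ≤ (n ^ 2 + ‖v‖ ^ 2) * (1 + p + q) ^ 2 := by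
          refine mul_le_mul_of_nonneg_left ?_ (by positivity)
          nlinarith [mul_nonneg hp hq]

/-! ### The bound on the transfer function -/

/-- The function `r ↦ ∑ 1 / (r + k²)` over `k ≥ 0`. -/
def recipSum (r : ℝ) : ℝ := ∑' k : ℕ, 1 / (r + (k : ℝ) ^ 2)

theorem summable_one_div_add_sq {r : ℝ} (hr : 0 < r) :
    Summable fun k : ℕ => 1 / (r + (k : ℝ) ^ 2) := by
  rw [← summable_nat_add_iff 1]
  refine Summable.of_nonneg_of_le (fun k => by positivity) (fun k => ?_)
    ((summable_nat_add_iff 1).2 (Real.summable_one_div_nat_pow.2 one_lt_two))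
  exact one_div_le_one_div_of_le (by positivity) (le_add_of_nonneg_left hr.le)

theorem tendsto_recipSum_atTop : Tendsto recipSum atTop (𝓝 0) := by
  rw [← tsum_zero (α := ℝ) (β := ℕ)]
  refine tendsto_tsum_of_dominated_convergence (summable_one_div_add_sq one_pos) (fun k => ?_) ?_
  · simp_rw [one_div]
    exact tendsto_inv_atTop_zero.comp (tendsto_atTop_add_const_right _ _ tendsto_id)
  · filter_upwards [eventually_ge_atTop 1] with r hr k
    rw [Real.norm_of_nonneg (by positivity)]
    exact one_div_le_one_div_of_le (by positivity) (by linarith)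

theorem add_le_sqrt_two_mul_norm {z : ℂ} : |z.re| + |z.im| ≤ √2 * ‖z‖ := by
  rw [Complex.norm_def, ← Real.sqrt_mul zero_le_two, Complex.normSq_apply]
  refine Real.le_sqrt_of_sq_le ?_
  rw [← abs_mul_abs_self z.re, ← abs_mul_abs_self z.im]
  nlinarith [sq_nonneg (|z.re| - |z.im|)]

/-- The distance of `k²` to the real number `w` dominates the square of the distance of `k` to the
nearest of two consecutive integers enclosing `√w` on the same side. -/
theorem exists_index_injection (w : ℝ) : ∃ e : ℕ+ → ℕ ⊕ ℕ, Function.Injective e ∧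
    ∀ k, ((Sum.elim id id (e k) : ℕ) : ℝ) ^ 2 ≤ |w - (k : ℝ) ^ 2| := by
  set n := ⌊√w⌋₊
  have hn2 : √w < n + 1 := Nat.lt_floor_add_one _
  have hs : 0 ≤ √w := Real.sqrt_nonneg _
  have hw2 : w < ((n : ℝ) + 1) ^ 2 := by
    rw [← Real.sqrt_lt' (by positivity)]; exact hn2
  -- With n = ⌊√w⌋: for k ≤ n, w - k² ≥ n² - k² ≥ (n - k)²; for k > n, k² - w ≥ k² - (n+1)² ≥ (k - n
  -- - 1)². Both sides can reach the index 0, hence two copies of ℕ. For w < 0 the real square root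
  -- is 0 and every k falls in the second case.
  refine ⟨fun k => if (k : ℕ) ≤ n then Sum.inl (n - k) else Sum.inr (k - n - 1), ?_, fun k => ?_⟩
  · intro j k h
    dsimp only at h
    split_ifs at h with h1 h2 h2
    · exact PNat.coe_injective (by have := Sum.inl_injective h; omega)
    · exact PNat.coe_injective (by have := Sum.inr_injective h; omega)
  · have hk : (1 : ℝ) ≤ k := by exact_mod_cast k.pos
    dsimp only
    split_ifs with h
    · have hnk : (k : ℝ) ≤ n := by exact_mod_cast h
      have hn1 : (n : ℝ) ≤ √w := Nat.floor_le hs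
      have hw : (n : ℝ) ^ 2 ≤ w := by
        rw [← Real.le_sqrt' (by linarith)]; exact hn1
      simp only [Sum.elim_inl, id, Nat.cast_sub h]
      refine le_trans ?_ (le_abs_self _)
      nlinarith
    · have h' : n + 1 ≤ (k : ℕ) := by omega
      have hnk : (n : ℝ) + 1 ≤ k := by exact_mod_cast h'
      have hc : (((k : ℕ) - n - 1 : ℕ) : ℝ) = k - (n + 1) := by
        rw [Nat.sub_sub, Nat.cast_sub h']; push_cast; ring
      simp only [Sum.elim_inr, id, hc]
      rw [abs_sub_comm]
      refine le_trans ?_ (le_abs_self _)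
      have : (0 : ℝ) ≤ n := Nat.cast_nonneg n
      nlinarith

/-- The factor √2 comes from |Re z| + |Im z| ≤ √2 |z|, the factor 2 from the two copies of ℕ in
`exists_index_injection`. The bound does not involve Im s. -/
theorem tsum_inv_sub_eigval_le (ha : 0 < a) {s : ℂ} (hs : 0 < s.re) :
    ∑' k, ‖(s - eigval a k)⁻¹‖ ≤ 2 * √2 / a * recipSum (s.re / a) := by
  obtain ⟨e, he, hek⟩ := exists_index_injection (s.im / a)
  have hr : 0 < s.re / a := by positivity
  set g : ℕ → ℝ := fun j => 1 / (s.re / a + (j : ℝ) ^ 2) with hg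
  have hgs : Summable g := summable_one_div_add_sq hr
  have hsum : HasSum (Sum.elim g g) (recipSum (s.re / a) + recipSum (s.re / a)) :=
    HasSum.sum (f := Sum.elim g g) hgs.hasSum hgs.hasSum
  have hle : ∀ k, ‖(s - eigval a k)⁻¹‖ ≤ √2 / a * Sum.elim g g (e k) := fun k => by
    have h1 : Sum.elim g g (e k) =
        1 / (s.re / a + ((Sum.elim id id (e k) : ℕ) : ℝ) ^ 2) := by
      cases e k <;> rfl
    rw [h1]
    set d := ((Sum.elim id id (e k) : ℕ) : ℝ) ^ 2
    have hd : d ≤ |s.im / a - (k : ℝ) ^ 2| := hek k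
    have hd0 : 0 ≤ d := by positivity
    have h2 := add_le_sqrt_two_mul_norm (z := s - eigval a k)
    rw [Complex.sub_re, Complex.sub_im, eigval_re, eigval_im, sub_zero, abs_of_pos hs] at h2
    have h3 : |s.im - a * (k : ℝ) ^ 2| = a * |s.im / a - (k : ℝ) ^ 2| := by
      rw [← abs_of_pos ha, ← abs_mul, abs_of_pos ha, mul_sub, mul_div_cancel₀ _ ha.ne']
    have h4 : a * (s.re / a + d) ≤ √2 * ‖s - eigval a k‖ := by
      refine le_trans ?_ h2
      rw [h3, mul_add, mul_div_cancel₀ _ ha.ne']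
      gcongr
    have h5 : 0 < ‖s - eigval a k‖ := hs.trans_le (re_le_norm_sub_eigval a s k)
    rw [norm_inv, div_mul_div_comm, mul_one, inv_le_comm₀ h5 (by positivity), inv_div,
      div_le_iff₀ (by positivity), mul_comm]
    linarith
  have hS := summable_inv_sub_eigval ha (mem_resolventSet_of_re_pos ha hs)
  calc ∑' k, ‖(s - eigval a k)⁻¹‖
      ≤ ∑' k, √2 / a * Sum.elim g g (e k) :=
        hS.tsum_le_tsum hle ((hsum.summable.comp_injective he).mul_left _)
    _ = √2 / a * ∑' k, Sum.elim g g (e k) := tsum_mul_left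
    _ ≤ √2 / a * ∑' j, Sum.elim g g j := by
        refine mul_le_mul_of_nonneg_left ?_ (by positivity)
        refine (hsum.summable.comp_injective he).tsum_le_tsum_of_inj e he (fun j _ => ?_)
          (fun k => le_rfl) hsum.summable
        cases j <;> simp only [Sum.elim_inl, Sum.elim_inr, hg] <;> positivity
    _ = _ := by rw [hsum.tsum_eq]; ring

/-- Uniformity in the finite set of modes is what the Fourier argument for the output requires. -/
theorem norm_sum_div_sub_eigval_le (ha : 0 < a) {s : ℂ} (hs : 0 < s.re) {m : ℕ+ → ℂ} {M : ℝ}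
    (hm : ∀ k, ‖m k‖ ≤ M) (S : Finset ℕ+) :
    ‖∑ k ∈ S, m k / (s - eigval a k)‖ ≤ 2 * √2 / a * M * recipSum (s.re / a) := by
  have hM : 0 ≤ M := (norm_nonneg _).trans (hm 1)
  have hS := summable_inv_sub_eigval ha (mem_resolventSet_of_re_pos ha hs)
  calc _ ≤ ∑ k ∈ S, M * ‖(s - eigval a k)⁻¹‖ := by
        refine norm_sum_le_of_le _ fun k _ => ?_
        rw [div_eq_mul_inv, norm_mul]
        exact mul_le_mul_of_nonneg_right (hm k) (norm_nonneg _)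
    _ = M * ∑ k ∈ S, ‖(s - eigval a k)⁻¹‖ := by rw [Finset.mul_sum]
    _ ≤ M * ∑' k, ‖(s - eigval a k)⁻¹‖ :=
        mul_le_mul_of_nonneg_left (hS.sum_le_tsum _ fun k _ => norm_nonneg _) hM
    _ ≤ M * (2 * √2 / a * recipSum (s.re / a)) :=
        mul_le_mul_of_nonneg_left (tsum_inv_sub_eigval_le ha hs) hM
    _ = _ := by ring

theorem norm_tsum_div_sub_eigval_le (ha : 0 < a) {s : ℂ} (hs : 0 < s.re) {m : ℕ+ → ℂ} {M : ℝ}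
    (hm : ∀ k, ‖m k‖ ≤ M) :
    ‖∑' k, m k / (s - eigval a k)‖ ≤ 2 * √2 / a * M * recipSum (s.re / a) := by
  have h : Summable fun k => m k / (s - eigval a k) :=
    (summable_mul_inv_sub_eigval ha (mem_resolventSet_of_re_pos ha hs) hm).of_norm
  exact le_of_tendsto h.hasSum.norm
    (Eventually.of_forall fun S => norm_sum_div_sub_eigval_le ha hs hm S)

theorem norm_transferFunction_le (ha : 0 < a) (hβ : β ∈ resolventSet (diagOp a))
    {b : XNeg (diagOp a) β} {C : XOne (diagOp a) β →L[ℂ] ℂ} {M₁ M₂ M : ℝ}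
    (hb : ∀ k, ‖component a β b k‖ ≤ M₁) (hc : ∀ k, ‖obsComponent a β C k‖ ≤ M₂)
    (hm : ∀ k, ‖component a β b k * obsComponent a β C k‖ ≤ M) {s : ℂ} (hs : 0 < s.re) (v : ℂ) :
    ‖transferFunction (diagOp a) β (controlOp a β b) (lambdaExt (diagOp a) β C) 0 s v‖ ≤
      2 * √2 / a * M * recipSum (s.re / a) * ‖v‖ := by
  have hb' : ∀ k, ‖component a β (controlOp a β b v) k‖ ≤ ‖v‖ * M₁ := fun k => by
    rw [controlOp, ContinuousLinearMap.toSpanSingleton_apply, component_smul hβ, norm_mul]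
    exact mul_le_mul_of_nonneg_left (hb k) (norm_nonneg _)
  rw [transferFunction, zero_apply, add_zero,
    applyOrZero_lambdaExt_resolventExt ha hβ (mem_resolventSet_of_re_pos ha hs) hb' hc]
  have : ∀ k, obsComponent a β C k * (component a β (controlOp a β b v) k / (s - eigval a k)) =
      v * (component a β b k * obsComponent a β C k / (s - eigval a k)) := fun k => by
    rw [controlOp, ContinuousLinearMap.toSpanSingleton_apply, component_smul hβ]
    ring
  simp_rw [this]
  rw [tsum_mul_left, norm_mul, mul_comm]
  exact mul_le_mul_of_nonneg_right (norm_tsum_div_sub_eigval_le ha hs hm) (norm_nonneg _)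

theorem strictlyProper_transferFunction (ha : 0 < a) (hβ : β ∈ resolventSet (diagOp a))
    {b : XNeg (diagOp a) β} {C : XOne (diagOp a) β →L[ℂ] ℂ} {M₁ M₂ M : ℝ}
    (hb : ∀ k, ‖component a β b k‖ ≤ M₁) (hc : ∀ k, ‖obsComponent a β C k‖ ≤ M₂)
    (hm : ∀ k, ‖component a β b k * obsComponent a β C k‖ ≤ M) :
    StrictlyProper
      (transferFunction (diagOp a) β (controlOp a β b) (lambdaExt (diagOp a) β C) 0) := by
  intro ε hε
  have h : Tendsto (fun r : ℝ => 2 * √2 / a * M * recipSum (r / a)) atTop (𝓝 0) := by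
    simpa using (tendsto_recipSum_atTop.comp (tendsto_id.atTop_div_const ha)).const_mul
      (2 * √2 / a * M)
  obtain ⟨α, hα⟩ :=
    ((h.eventually (gt_mem_nhds hε)).and (eventually_gt_atTop 0)).exists_forall_of_atTop
  refine ⟨α, fun s hs v => ?_⟩
  obtain ⟨h1, h2⟩ := hα s.re hs.le
  refine (norm_transferFunction_le ha hβ hb hc hm h2 v).trans ?_
  exact mul_le_mul_of_nonneg_right h1.le (norm_nonneg _)

/-! ### Fourier estimates on [0, τ] -/

theorem memLp_two_of_continuousOn {τ : ℝ} {u : ℝ → ℂ} (hu : ContinuousOn u (Icc 0 τ)) :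
    MemLp u 2 (volume.restrict (Ioc 0 τ)) := by
  obtain ⟨K, hK⟩ := isCompact_Icc.exists_bound_of_continuousOn hu
  refine MemLp.of_bound ((hu.mono Ioc_subset_Icc_self).aestronglyMeasurable measurableSet_Ioc) K ?_
  filter_upwards [ae_restrict_mem measurableSet_Ioc] with t ht using hK t (Ioc_subset_Icc_self ht)

theorem intervalIntegrable_norm_sq {τ : ℝ} (hτ : 0 ≤ τ) {u : ℝ → ℂ}
    (hu : ContinuousOn u (Icc 0 τ)) : IntervalIntegrable (fun t => ‖u t‖ ^ 2) volume 0 τ :=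
  ContinuousOn.intervalIntegrable_of_Icc hτ (hu.norm.pow 2)

/-- A length `N · 2π/a ≥ τ` that is a multiple of the period of all `e^{i a k² t}`. -/
theorem exists_period_multiple (ha : 0 < a) (τ : ℝ) :
    ∃ N : ℕ, 0 < N ∧ τ ≤ N * (2 * Real.pi / a) := by
  have hp : 0 < 2 * Real.pi / a := by positivity
  obtain ⟨N, hN⟩ := exists_nat_ge (τ / (2 * Real.pi / a))
  refine ⟨N + 1, N.succ_pos, ?_⟩
  rw [div_le_iff₀ hp] at hN
  push_cast
  nlinarith

/-- Bessel's inequality on [0, L], L = N · 2π/a, for u extended by zero: there the e^{λ_k t} are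
distinct members of the trigonometric system. -/
theorem sum_sq_integral_exp_le (ha : 0 < a) {τ : ℝ} (hτ : 0 < τ) {N : ℕ} (hN : 0 < N)
    (hNτ : τ ≤ N * (2 * Real.pi / a)) {u : ℝ → ℂ} (hu : ContinuousOn u (Icc 0 τ))
    (S : Finset ℕ+) :
    ∑ k ∈ S, ‖∫ t in (0 : ℝ)..τ, Complex.exp (-(eigval a k * t)) * u t‖ ^ 2 ≤
      N * (2 * Real.pi / a) * ∫ t in (0 : ℝ)..τ, ‖u t‖ ^ 2 := by
  set L : ℝ := N * (2 * Real.pi / a) with hL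
  have hL0 : 0 < L := hτ.trans_le hNτ
  have hsub : Ioc 0 τ ⊆ Ioc 0 L := Ioc_subset_Ioc_right hNτ
  have hind : ∀ {E : Type} [NormedAddCommGroup E] [NormedSpace ℝ E] (f : ℝ → E),
      ∫ t in (0 : ℝ)..L, (Ioc 0 τ).indicator f t = ∫ t in (0 : ℝ)..τ, f t := fun f => by
    rw [intervalIntegral.integral_of_le hL0.le, intervalIntegral.integral_of_le hτ.le,
      setIntegral_indicator measurableSet_Ioc, inter_eq_self_of_subset_right hsub]
  have hf : MemLp ((Ioc 0 τ).indicator u) 2 (volume.restrict (Ioc 0 L)) := by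
    rw [memLp_indicator_iff_restrict measurableSet_Ioc,
      Measure.restrict_restrict measurableSet_Ioc, inter_eq_self_of_subset_left hsub]
    exact memLp_two_of_continuousOn hu
  have hP := hasSum_sq_fourierCoeffOn hL0 hf
  have hnorm : ∫ t in (0 : ℝ)..L, ‖(Ioc 0 τ).indicator u t‖ ^ 2 =
      ∫ t in (0 : ℝ)..τ, ‖u t‖ ^ 2 := by
    rw [← hind]
    congr 1 with t
    by_cases ht : t ∈ Ioc 0 τ <;> simp [ht]
  rw [hnorm, sub_zero, smul_eq_mul] at hP
  -- Frequency index N k² on an interval of length L is the angular frequency 2πNk²/L = a k².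
  have hcoef : ∀ k : ℕ+, fourierCoeffOn hL0 ((Ioc 0 τ).indicator u) (N * (k : ℕ) ^ 2 : ℕ) =
      (L : ℂ)⁻¹ * ∫ t in (0 : ℝ)..τ, Complex.exp (-(eigval a k * t)) * u t := fun k => by
    rw [fourierCoeffOn_eq_integral, ← hind]
    simp only [sub_zero, one_div, Complex.real_smul, Complex.ofReal_inv]
    congr 2 with t
    by_cases ht : t ∈ Ioc 0 τ
    · rw [indicator_of_mem ht, indicator_of_mem ht, fourier_coe_apply, smul_eq_mul]
      congr 2
      have h1 : (a : ℂ) ≠ 0 := by exact_mod_cast ha.ne'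
      have h2 : (N : ℂ) ≠ 0 := by exact_mod_cast hN.ne'
      have h3 : (Real.pi : ℂ) ≠ 0 := by exact_mod_cast Real.pi_ne_zero
      rw [sub_zero, hL, eigval]
      push_cast
      field_simp
    · rw [indicator_of_notMem ht, indicator_of_notMem ht, smul_zero]
  have hinj : Function.Injective fun k : ℕ+ => ((N * (k : ℕ) ^ 2 : ℕ) : ℤ) := fun j k h => by
    have h1 : N * (j : ℕ) ^ 2 = N * (k : ℕ) ^ 2 := Nat.cast_injective (R := ℤ) h
    have h2 := Nat.eq_of_mul_eq_mul_left hN h1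
    exact PNat.coe_injective (Nat.pow_left_injective two_ne_zero h2)
  have h3 := (hP.summable.sum_le_tsum (S.map ⟨_, hinj⟩) fun n _ => sq_nonneg _).trans_eq hP.tsum_eq
  rw [Finset.sum_map] at h3
  simp only [Function.Embedding.coeFn_mk, hcoef, norm_mul, mul_pow, ← Finset.mul_sum, norm_inv,
    Complex.norm_real, Real.norm_eq_abs, abs_of_pos hL0] at h3
  rw [inv_pow, inv_mul_le_iff₀ (by positivity)] at h3
  refine h3.trans_eq ?_
  field_simp

theorem conj_exp_eigval (a : ℝ) (k : ℕ+) (t : ℝ) :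
    star (Complex.exp (eigval a k * t)) = Complex.exp (-(eigval a k * t)) := by
  rw [RCLike.star_def, ← Complex.exp_conj, map_mul, Complex.conj_ofReal, eigval_eq, map_mul,
    Complex.conj_I, Complex.conj_ofReal]
  ring_nf

/-- The dual of `sum_sq_integral_exp_le`: I = ∫|f|² equals ∑ z̄_k g_k, so Cauchy–Schwarz and
Bessel's inequality for f itself give I² ≤ (∑|z_k|²) · L · I, and I cancels. -/
theorem integral_norm_sq_sum_exp_le (ha : 0 < a) {τ : ℝ} (hτ : 0 < τ) {N : ℕ} (hN : 0 < N)
    (hNτ : τ ≤ N * (2 * Real.pi / a)) (z : ℕ+ → ℂ) (S : Finset ℕ+) :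
    ∫ t in (0 : ℝ)..τ, ‖∑ k ∈ S, z k * Complex.exp (eigval a k * t)‖ ^ 2 ≤
      N * (2 * Real.pi / a) * ∑ k ∈ S, ‖z k‖ ^ 2 := by
  set f : ℝ → ℂ := fun t => ∑ k ∈ S, z k * Complex.exp (eigval a k * t) with hf
  have hfc : Continuous f := by fun_prop
  set g : ℕ+ → ℂ := fun k => ∫ t in (0 : ℝ)..τ, Complex.exp (-(eigval a k * t)) * f t with hg
  set I := ∫ t in (0 : ℝ)..τ, ‖f t‖ ^ 2 with hI
  have hI0 : 0 ≤ I := intervalIntegral.integral_nonneg hτ.le fun t _ => by positivity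
  have hB := sum_sq_integral_exp_le ha hτ hN hNτ hfc.continuousOn S
  have h1 : (I : ℂ) = ∑ k ∈ S, star (z k) * g k := by
    rw [hI, ← intervalIntegral.integral_ofReal]
    simp only [hg, ← intervalIntegral.integral_const_mul]
    rw [← intervalIntegral.integral_finsetSum fun k _ => by
      apply Continuous.intervalIntegrable; fun_prop]
    congr 1 with t
    have : (((‖f t‖ ^ 2 : ℝ)) : ℂ) = star (f t) * f t := by
      rw [RCLike.star_def, Complex.conj_mul']; push_cast; rfl
    rw [this]
    conv_lhs => rw [hf]
    simp only [star_sum, star_mul', conj_exp_eigval, Finset.sum_mul, mul_assoc]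
    rfl
  have h2 : I ≤ ∑ k ∈ S, ‖z k‖ * ‖g k‖ := by
    have : I = ‖(I : ℂ)‖ := by rw [Complex.norm_real, Real.norm_of_nonneg hI0]
    rw [this, h1]
    exact norm_sum_le_of_le _ fun k _ => by rw [norm_mul, norm_star]
  have h3 : I ^ 2 ≤ (∑ k ∈ S, ‖z k‖ ^ 2) * (N * (2 * Real.pi / a) * I) :=
    (pow_le_pow_left₀ hI0 h2 2).trans ((Finset.sum_mul_sq_le_sq_mul_sq S _ _).trans
      (mul_le_mul_of_nonneg_left hB (Finset.sum_nonneg fun k _ => by positivity)))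
  rcases hI0.eq_or_lt with h0 | h0
  · rw [← h0]; positivity
  · refine le_of_mul_le_mul_right ?_ h0
    nlinarith

/-- Comparison of `L²` norms through Fourier coefficients. -/
theorem integral_norm_sq_le_of_fourier {τ G : ℝ} (hτ : 0 < τ) {w v : ℝ → ℂ}
    (hw : ContinuousOn w (Icc 0 τ)) (hv : ContinuousOn v (Icc 0 τ))
    (h : ∀ n : ℤ, ‖∫ t in (0 : ℝ)..τ, Complex.exp (-(2 * Real.pi * n / τ * Complex.I * t)) * w t‖ ≤
      G * ‖∫ t in (0 : ℝ)..τ, Complex.exp (-(2 * Real.pi * n / τ * Complex.I * t)) * v t‖) :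
    ∫ t in (0 : ℝ)..τ, ‖w t‖ ^ 2 ≤ G ^ 2 * ∫ t in (0 : ℝ)..τ, ‖v t‖ ^ 2 := by
  have hc : ∀ (f : ℝ → ℂ) (n : ℤ), ‖fourierCoeffOn hτ f n‖ = τ⁻¹ *
      ‖∫ t in (0 : ℝ)..τ, Complex.exp (-(2 * Real.pi * n / τ * Complex.I * t)) * f t‖ := by
    intro f n
    rw [fourierCoeffOn_eq_integral, norm_smul, sub_zero, one_div, norm_inv, Real.norm_eq_abs,
      abs_of_pos hτ]
    congr 3 with t
    rw [fourier_coe_apply, smul_eq_mul]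
    congr 2
    push_cast
    ring
  have h1 := hasSum_sq_fourierCoeffOn hτ (memLp_two_of_continuousOn hw)
  have h2 := (hasSum_sq_fourierCoeffOn hτ (memLp_two_of_continuousOn hv)).mul_left (G ^ 2)
  have h3 := hasSum_le (fun n => ?_) h1 h2
  · rw [sub_zero, smul_eq_mul, smul_eq_mul, mul_left_comm] at h3
    exact le_of_mul_le_mul_left h3 (by positivity)
  · rw [← mul_pow, hc, hc, mul_left_comm]
    exact pow_le_pow_left₀ (by positivity) (mul_le_mul_of_nonneg_left (h n) (by positivity)) 2

/-- The derivative of e^{-μt}x is integrated. With μ = l this is the variation of constants formula;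
with e^{-μτ} = 1 and x(τ) = x(0) it relates Fourier coefficients of x and u. -/
theorem integral_exp_mul_of_deriv {τ : ℝ} (hτ : 0 ≤ τ) {x u : ℝ → ℂ} {l b μ : ℂ}
    (hx : ContinuousOn x (Icc 0 τ)) (hu : ContinuousOn u (Icc 0 τ))
    (hd : ∀ t ∈ Ioo 0 τ, HasDerivAt x (l * x t + b * u t) t) :
    (μ - l) * (∫ t in (0 : ℝ)..τ, Complex.exp (-(μ * t)) * x t) =
      b * (∫ t in (0 : ℝ)..τ, Complex.exp (-(μ * t)) * u t) -
        (Complex.exp (-(μ * τ)) * x τ - x 0) := by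
  have he : Continuous fun t : ℝ => Complex.exp (-(μ * t)) := by fun_prop
  have hxe : ContinuousOn (fun t : ℝ => Complex.exp (-(μ * t)) * x t) (Icc 0 τ) :=
    he.continuousOn.mul hx
  have hue : ContinuousOn (fun t : ℝ => Complex.exp (-(μ * t)) * u t) (Icc 0 τ) :=
    he.continuousOn.mul hu
  have hxi := hxe.intervalIntegrable_of_Icc (μ := volume) hτ
  have hui := hue.intervalIntegrable_of_Icc (μ := volume) hτ
  have h := intervalIntegral.integral_eq_sub_of_hasDerivAt_of_le hτ hxe
    (f' := fun t => (l - μ) * (Complex.exp (-(μ * t)) * x t) +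
      b * (Complex.exp (-(μ * t)) * u t)) (fun t ht => ?_)
    ((hxi.const_mul _).add (hui.const_mul _))
  · rw [intervalIntegral.integral_add (hxi.const_mul _) (hui.const_mul _),
      intervalIntegral.integral_const_mul, intervalIntegral.integral_const_mul] at h
    simp only [Complex.ofReal_zero, mul_zero, neg_zero, Complex.exp_zero, one_mul] at h
    linear_combination -h
  · have h1 : HasDerivAt (fun t : ℝ => -(μ * (t : ℂ))) (-μ) t := by
      simpa using (Complex.ofRealCLM.hasDerivAt (x := t)).const_mul (-μ)
    refine (h1.cexp.mul (hd t ht)).congr_deriv ?_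
    ring

theorem norm_add_sq_le_two_mul {E : Type*} [SeminormedAddCommGroup E] (x y : E) :
    ‖x + y‖ ^ 2 ≤ 2 * (‖x‖ ^ 2 + ‖y‖ ^ 2) := by
  have := pow_le_pow_left₀ (norm_nonneg _) (norm_add_le x y) 2
  nlinarith [sq_nonneg (‖x‖ - ‖y‖)]

/-! ### Output and state estimates for finitely many modes -/

/-- The output estimate for periodic solutions of finitely many damped modes. -/
theorem integral_norm_sq_periodic_le (ha : 0 < a) {τ : ℝ} (hτ : 0 < τ) {b c : ℕ+ → ℂ} {M : ℝ}
    (hm : ∀ k, ‖c k * b k‖ ≤ M) {w : ℕ+ → ℝ → ℂ} {v : ℝ → ℂ}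
    (hw : ∀ k, ContinuousOn (w k) (Icc 0 τ)) (hv : ContinuousOn v (Icc 0 τ))
    (hd : ∀ k, ∀ t ∈ Ioo 0 τ, HasDerivAt (w k) ((eigval a k - 1) * w k t + b k * v t) t)
    (hper : ∀ k, w k τ = w k 0) (S : Finset ℕ+) :
    ∫ t in (0 : ℝ)..τ, ‖∑ k ∈ S, c k * w k t‖ ^ 2 ≤
      (2 * √2 / a * M * recipSum (1 / a)) ^ 2 * ∫ t in (0 : ℝ)..τ, ‖v t‖ ^ 2 := by
  refine integral_norm_sq_le_of_fourier hτ (continuousOn_finsetSum _ fun k _ =>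
    continuousOn_const.mul (hw k)) hv fun n => ?_
  set μ : ℂ := 2 * Real.pi * n / τ * Complex.I with hμ
  -- The damping moves the evaluation point from μ to 1 + μ, on the line Re s = 1, where the bound
  -- on the truncated transfer function is independent of n.
  have hμre : (1 + μ).re = 1 := by
    have : μ = ((2 * Real.pi * n / τ : ℝ) : ℂ) * Complex.I := by rw [hμ]; push_cast; ring
    rw [Complex.add_re, this, Complex.re_ofReal_mul, Complex.I_re, mul_zero, Complex.one_re,
      add_zero]
  have hμτ : Complex.exp (-(μ * τ)) = 1 := by
    rw [Complex.exp_eq_one_iff]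
    refine ⟨-n, ?_⟩
    have : (τ : ℂ) ≠ 0 := by exact_mod_cast hτ.ne'
    rw [hμ]
    push_cast
    field_simp
  have he : ContinuousOn (fun t : ℝ => Complex.exp (-(μ * t))) (Icc 0 τ) :=
    Continuous.continuousOn (by fun_prop)
  have hk : ∀ k, ∫ t in (0 : ℝ)..τ, Complex.exp (-(μ * t)) * w k t =
      b k / (1 + μ - eigval a k) * ∫ t in (0 : ℝ)..τ, Complex.exp (-(μ * t)) * v t := fun k => by
    have h := integral_exp_mul_of_deriv (μ := μ) hτ.le (hw k) hv (hd k)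
    rw [hμτ, one_mul, hper, sub_self, sub_zero] at h
    have h0 : 1 + μ - eigval a k ≠ 0 :=
      sub_eigval_ne_zero (mem_resolventSet_of_re_pos ha (hμre ▸ one_pos)) k
    rw [div_mul_eq_mul_div, eq_div_iff h0, ← h]
    ring
  have hsum : ∫ t in (0 : ℝ)..τ, Complex.exp (-(μ * t)) * ∑ k ∈ S, c k * w k t =
      (∑ k ∈ S, c k * b k / (1 + μ - eigval a k)) *
        ∫ t in (0 : ℝ)..τ, Complex.exp (-(μ * t)) * v t := by
    simp_rw [Finset.mul_sum, mul_left_comm _ (c _)]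
    rw [intervalIntegral.integral_finsetSum fun k _ => ?_, Finset.sum_mul]
    · refine Finset.sum_congr rfl fun k _ => ?_
      rw [intervalIntegral.integral_const_mul, hk]
      ring
    · exact ((he.mul (hw k)).intervalIntegrable_of_Icc hτ.le).const_mul _
  rw [hsum, norm_mul]
  refine mul_le_mul_of_nonneg_right ?_ (norm_nonneg _)
  have := norm_sum_div_sub_eigval_le ha (hμre ▸ one_pos) hm S
  rwa [hμre] at this

/-- The output estimate for finitely many modes. -/
theorem exists_output_estimate (ha : 0 < a) {τ : ℝ} (hτ : 0 < τ) {b c : ℕ+ → ℂ} {M₁ M₂ : ℝ}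
    (hb : ∀ k, ‖b k‖ ≤ M₁) (hc : ∀ k, ‖c k‖ ≤ M₂) :
    ∃ K : ℝ, 0 ≤ K ∧ ∀ (x : ℕ+ → ℝ → ℂ) (u : ℝ → ℂ),
      (∀ k, ContinuousOn (x k) (Icc 0 τ)) → ContinuousOn u (Icc 0 τ) →
      (∀ k, ∀ t ∈ Ioo 0 τ, HasDerivAt (x k) (eigval a k * x k t + b k * u t) t) →
      ∀ S : Finset ℕ+, ∫ t in (0 : ℝ)..τ, ‖∑ k ∈ S, c k * x k t‖ ^ 2 ≤
        K * (∑ k ∈ S, ‖x k 0‖ ^ 2 + ∑ k ∈ S, ‖x k τ‖ ^ 2 + ∫ t in (0 : ℝ)..τ, ‖u t‖ ^ 2) := by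
  obtain ⟨N, hN, hNτ⟩ := exists_period_multiple ha τ
  set L : ℝ := N * (2 * Real.pi / a) with hL
  have hL0 : 0 < L := hτ.trans_le hNτ
  set G := 2 * √2 / a * (M₂ * M₁) * recipSum (1 / a)
  have hm : ∀ k, ‖c k * b k‖ ≤ M₂ * M₁ := fun k => by
    rw [norm_mul]
    exact mul_le_mul (hc k) (hb k) (norm_nonneg _) ((norm_nonneg _).trans (hc k))
  -- A lower bound for |1 - e^{(λ_k - 1)τ}|, uniform in k. Without damping, 1 - e^{λ_k τ} may vanish
  -- and no periodic correction need exist.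
  set δ := 1 - Real.exp (-τ) with hδ
  have hδ0 : 0 < δ := sub_pos.2 (by rw [← Real.exp_zero]; exact Real.exp_lt_exp.2 (by linarith))
  -- `P` bounds the periodic part, with e^τ the cost of undoing the damping; `Q` bounds the free
  -- correction.
  set P := 2 * Real.exp τ ^ 2 * G ^ 2
  set Q := 2 * (L * (M₂ ^ 2 * (2 * (δ⁻¹) ^ 2)))
  have hP : 0 ≤ P := by positivity
  have hQ : 0 ≤ Q := by positivity
  refine ⟨P + Q, by positivity, fun x u hx hu hd S => ?_⟩
  have hden : ∀ k, δ ≤ ‖1 - Complex.exp ((eigval a k - 1) * τ)‖ := fun k => by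
    have h1 : ‖Complex.exp ((eigval a k - 1) * τ)‖ = Real.exp (-τ) := by
      rw [Complex.norm_exp]; simp [eigval_re]
    have h2 := norm_sub_norm_le (1 : ℂ) (Complex.exp ((eigval a k - 1) * τ))
    rwa [h1, norm_one] at h2
  -- The initial value of the damped free motion that makes `w k` periodic. It involves x(τ) as well
  -- as x(0), hence the terminal term in the estimate, removed later by the state estimate.
  set ξ : ℕ+ → ℂ := fun k =>
    (Complex.exp (-τ) * x k τ - x k 0) / (1 - Complex.exp ((eigval a k - 1) * τ)) with hξ
  set w : ℕ+ → ℝ → ℂ := fun k t =>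
    Complex.exp (-t) * x k t + ξ k * Complex.exp ((eigval a k - 1) * t) with hw
  set v : ℝ → ℂ := fun t => Complex.exp (-t) * u t with hv
  have hexp : Continuous fun t : ℝ => Complex.exp (-t) := by fun_prop
  have hwc : ∀ k, ContinuousOn (w k) (Icc 0 τ) := fun k =>
    (hexp.continuousOn.mul (hx k)).add (Continuous.continuousOn (by fun_prop))
  have hvc : ContinuousOn v (Icc 0 τ) := hexp.continuousOn.mul hu
  have hwd : ∀ k, ∀ t ∈ Ioo 0 τ,
      HasDerivAt (w k) ((eigval a k - 1) * w k t + b k * v t) t := fun k t ht => by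
    have h1 : HasDerivAt (fun t : ℝ => -(t : ℂ)) (-1) t := by
      simpa using (Complex.ofRealCLM.hasDerivAt (x := t)).const_mul (-1)
    have h2 : HasDerivAt (fun t : ℝ => (eigval a k - 1) * (t : ℂ)) (eigval a k - 1) t := by
      simpa using (Complex.ofRealCLM.hasDerivAt (x := t)).const_mul (eigval a k - 1)
    refine ((h1.cexp.mul (hd k t ht)).add (h2.cexp.const_mul (ξ k))).congr_deriv ?_
    simp only [hw, hv]
    ring
  have hper : ∀ k, w k τ = w k 0 := fun k => by
    have h0 : 1 - Complex.exp ((eigval a k - 1) * τ) ≠ 0 :=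
      norm_pos_iff.1 (hδ0.trans_le (hden k))
    have h1 : ξ k * (1 - Complex.exp ((eigval a k - 1) * τ)) =
        Complex.exp (-τ) * x k τ - x k 0 := div_mul_cancel₀ _ h0
    simp only [hw, Complex.ofReal_zero, neg_zero, mul_zero, Complex.exp_zero, one_mul, mul_one]
    linear_combination -h1
  have hW := integral_norm_sq_periodic_le ha hτ hm hwc hvc hwd hper S
  have hF := integral_norm_sq_sum_exp_le ha hτ hN hNτ (fun k => c k * ξ k) S
  have hvu : ∫ t in (0 : ℝ)..τ, ‖v t‖ ^ 2 ≤ ∫ t in (0 : ℝ)..τ, ‖u t‖ ^ 2 := by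
    refine intervalIntegral.integral_mono_on hτ.le (intervalIntegrable_norm_sq hτ.le hvc)
      (intervalIntegrable_norm_sq hτ.le hu) fun t ht => ?_
    refine pow_le_pow_left₀ (norm_nonneg _) ?_ 2
    rw [hv, norm_mul, Complex.norm_exp]
    refine mul_le_of_le_one_left (norm_nonneg _) ?_
    simpa using ht.1
  have hξle : ∑ k ∈ S, ‖c k * ξ k‖ ^ 2 ≤
      M₂ ^ 2 * (2 * (δ⁻¹) ^ 2) * (∑ k ∈ S, ‖x k 0‖ ^ 2 + ∑ k ∈ S, ‖x k τ‖ ^ 2) := by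
    rw [← Finset.sum_add_distrib, Finset.mul_sum]
    refine Finset.sum_le_sum fun k _ => ?_
    have h1 : ‖ξ k‖ ≤ δ⁻¹ * (‖x k 0‖ + ‖x k τ‖) := by
      rw [hξ, norm_div, div_eq_inv_mul]
      refine mul_le_mul (inv_anti₀ hδ0 (hden k)) ?_ (norm_nonneg _) (by positivity)
      refine (norm_sub_le _ _).trans ?_
      rw [add_comm, norm_mul, Complex.norm_exp]
      refine add_le_add le_rfl (mul_le_of_le_one_left (norm_nonneg _) ?_)
      simpa using hτ.le
    have h2 : ‖ξ k‖ ^ 2 ≤ 2 * δ⁻¹ ^ 2 * (‖x k 0‖ ^ 2 + ‖x k τ‖ ^ 2) := by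
      refine (pow_le_pow_left₀ (norm_nonneg _) h1 2).trans ?_
      rw [mul_pow, mul_comm 2 (δ⁻¹ ^ 2), mul_assoc]
      refine mul_le_mul_of_nonneg_left ?_ (by positivity)
      nlinarith [sq_nonneg (‖x k 0‖ - ‖x k τ‖)]
    rw [norm_mul, mul_pow, mul_assoc]
    exact mul_le_mul (pow_le_pow_left₀ (norm_nonneg _) (hc k) 2) h2 (by positivity)
      (by positivity)
  set W : ℝ → ℂ := fun t => ∑ k ∈ S, c k * w k t with hWdef
  set f : ℝ → ℂ := fun t => ∑ k ∈ S, c k * ξ k * Complex.exp (eigval a k * t) with hf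
  have hWc : ContinuousOn W (Icc 0 τ) :=
    continuousOn_finsetSum _ fun k _ => continuousOn_const.mul (hwc k)
  have hfc : ContinuousOn f (Icc 0 τ) := Continuous.continuousOn (by fun_prop)
  have hyc : ContinuousOn (fun t => ∑ k ∈ S, c k * x k t) (Icc 0 τ) :=
    continuousOn_finsetSum _ fun k _ => continuousOn_const.mul (hx k)
  have hWi := intervalIntegrable_norm_sq hτ.le hWc
  have hfi := intervalIntegrable_norm_sq hτ.le hfc
  have hpt : ∀ t ∈ Icc 0 τ, ‖∑ k ∈ S, c k * x k t‖ ^ 2 ≤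
      2 * Real.exp τ ^ 2 * ‖W t‖ ^ 2 + 2 * ‖f t‖ ^ 2 := fun t ht => by
    -- Undoing the damping turns the correction into an undamped free motion, whose output f is
    -- controlled by `integral_norm_sq_sum_exp_le`.
    have h1 : ∑ k ∈ S, c k * x k t = Complex.exp t * W t + -f t := by
      rw [hWdef, hf]
      simp only [Finset.mul_sum, ← Finset.sum_neg_distrib, ← Finset.sum_add_distrib]
      refine Finset.sum_congr rfl fun k _ => ?_
      simp only [hw]
      have e1 : Complex.exp t * Complex.exp (-t) = 1 := by
        rw [← Complex.exp_add, add_neg_cancel, Complex.exp_zero]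
      have e2 : Complex.exp t * Complex.exp ((eigval a k - 1) * t) =
          Complex.exp (eigval a k * t) := by
        rw [← Complex.exp_add]; ring_nf
      linear_combination (-c k * x k t) * e1 - (c k * ξ k) * e2
    rw [h1]
    refine (norm_add_sq_le_two_mul _ _).trans ?_
    rw [norm_neg, mul_add, norm_mul, mul_pow, mul_assoc]
    refine add_le_add (mul_le_mul_of_nonneg_left (mul_le_mul_of_nonneg_right ?_ ?_) ?_) le_rfl
    · rw [Complex.norm_exp, Complex.ofReal_re]
      exact pow_le_pow_left₀ (Real.exp_pos _).le (Real.exp_le_exp.2 ht.2) 2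
    · positivity
    · positivity
  have hmono := intervalIntegral.integral_mono_on hτ.le (intervalIntegrable_norm_sq hτ.le hyc)
    ((hWi.const_mul (2 * Real.exp τ ^ 2)).add (hfi.const_mul 2)) hpt
  rw [intervalIntegral.integral_add (hWi.const_mul _) (hfi.const_mul _),
    intervalIntegral.integral_const_mul, intervalIntegral.integral_const_mul] at hmono
  set E := ∑ k ∈ S, ‖x k 0‖ ^ 2 + ∑ k ∈ S, ‖x k τ‖ ^ 2
  set V := ∫ t in (0 : ℝ)..τ, ‖u t‖ ^ 2
  have hE : 0 ≤ E := by positivity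
  have hV : 0 ≤ V := intervalIntegral.integral_nonneg hτ.le fun t _ => by positivity
  have hW2 : 2 * Real.exp τ ^ 2 * ∫ t in (0 : ℝ)..τ, ‖W t‖ ^ 2 ≤ P * V := by
    rw [mul_assoc (2 * Real.exp τ ^ 2)]
    refine mul_le_mul_of_nonneg_left (hW.trans ?_) (by positivity)
    exact mul_le_mul_of_nonneg_left hvu (by positivity)
  have hF2 : 2 * ∫ t in (0 : ℝ)..τ, ‖f t‖ ^ 2 ≤ Q * E := by
    rw [mul_assoc 2, mul_assoc L]
    refine mul_le_mul_of_nonneg_left (hF.trans ?_) zero_le_two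
    exact mul_le_mul_of_nonneg_left hξle hL0.le
  nlinarith [mul_nonneg hP hE, mul_nonneg hQ hV]

/-- The state estimate for finitely many modes. -/
theorem exists_state_estimate (ha : 0 < a) {τ : ℝ} (hτ : 0 < τ) {b : ℕ+ → ℂ} {M₁ : ℝ}
    (hb : ∀ k, ‖b k‖ ≤ M₁) :
    ∃ K : ℝ, 0 ≤ K ∧ ∀ (x : ℕ+ → ℝ → ℂ) (u : ℝ → ℂ),
      (∀ k, ContinuousOn (x k) (Icc 0 τ)) → ContinuousOn u (Icc 0 τ) →
      (∀ k, ∀ t ∈ Ioo 0 τ, HasDerivAt (x k) (eigval a k * x k t + b k * u t) t) →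
      ∀ S : Finset ℕ+, ∑ k ∈ S, ‖x k τ‖ ^ 2 ≤
        2 * ∑ k ∈ S, ‖x k 0‖ ^ 2 + K * ∫ t in (0 : ℝ)..τ, ‖u t‖ ^ 2 := by
  obtain ⟨N, hN, hNτ⟩ := exists_period_multiple ha τ
  refine ⟨2 * M₁ ^ 2 * (N * (2 * Real.pi / a)), by positivity, fun x u hx hu hd S => ?_⟩
  have hB := sum_sq_integral_exp_le ha hτ hN hNτ hu S
  have hk : ∀ k, ‖x k τ‖ ^ 2 ≤ 2 * ‖x k 0‖ ^ 2 + 2 * M₁ ^ 2 *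
      ‖∫ t in (0 : ℝ)..τ, Complex.exp (-(eigval a k * t)) * u t‖ ^ 2 := fun k => by
    -- At μ = λ_k the left side vanishes, which leaves x_k(τ) in terms of x_k(0) and an integral
    -- covered by Bessel's inequality.
    have h := integral_exp_mul_of_deriv (μ := eigval a k) hτ.le (hx k) hu (hd k)
    rw [sub_self, zero_mul] at h
    have h1 : ‖x k τ‖ = ‖x k 0 + b k * ∫ t in (0 : ℝ)..τ,
        Complex.exp (-(eigval a k * t)) * u t‖ := by
      have h2 : ‖Complex.exp (-(eigval a k * τ)) * x k τ‖ = ‖x k τ‖ := by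
        rw [norm_mul, ← conj_exp_eigval, norm_star, norm_exp_eigval_mul, one_mul]
      rw [← h2]
      congr 1
      linear_combination h
    rw [h1]
    refine (norm_add_sq_le_two_mul _ _).trans ?_
    rw [mul_add, norm_mul, mul_pow, mul_assoc]
    refine add_le_add le_rfl (mul_le_mul_of_nonneg_left (mul_le_mul_of_nonneg_right ?_ ?_) ?_)
    · exact pow_le_pow_left₀ (norm_nonneg _) (hb k) 2
    · positivity
    · positivity
  refine (Finset.sum_le_sum fun k _ => hk k).trans ?_
  rw [Finset.sum_add_distrib, ← Finset.mul_sum, ← Finset.mul_sum, mul_assoc (2 * M₁ ^ 2)]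
  exact add_le_add le_rfl (mul_le_mul_of_nonneg_left hB (by positivity))

/-! ### Well-posedness and conclusion -/

/-- Coordinates of a classical solution satisfy scalar equations, so the finite estimates apply to
every finite set of modes. As C_Λ is not assumed bounded on l², the passage to all modes in the
output uses a majorant supplied by the state equation. -/
theorem wellPosed_lambdaExt (ha : 0 < a) (hβ : β ∈ resolventSet (diagOp a))
    {b : XNeg (diagOp a) β} {C : XOne (diagOp a) β →L[ℂ] ℂ} {M₁ M₂ : ℝ}
    (hb : ∀ k, ‖component a β b k‖ ≤ M₁) (hc : ∀ k, ‖obsComponent a β C k‖ ≤ M₂) :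
    WellPosed (diagOp a) β (controlOp a β b) (lambdaExt (diagOp a) β C) 0 := by
  intro τ hτ
  obtain ⟨K₁, hK₁, hstate⟩ := exists_state_estimate ha hτ hb
  obtain ⟨K₂, hK₂, hout⟩ := exists_output_estimate ha hτ hb hc
  refine ⟨2 + K₁ + K₂ * (3 + K₁) + 1, by positivity, fun x u y hsol => ?_⟩
  have hIcc : Icc 0 τ ⊆ Ici 0 := Icc_subset_Ici_self
  set x' : ℝ → SeqSpace := derivWithin x (Ici 0) with hx'
  have hxc : ContinuousOn x (Icc 0 τ) := hsol.state_C1.continuousOn.mono hIcc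
  have hx'c : ContinuousOn x' (Icc 0 τ) :=
    (hsol.state_C1.continuousOn_derivWithin (uniqueDiffOn_Ici 0) le_rfl).mono hIcc
  have huc : ContinuousOn u (Icc 0 τ) := hsol.input_cont.mono hIcc
  let ev : ℕ+ → SeqSpace →L[ℝ] ℂ := fun k =>
    (lp.evalCLM ℂ (fun _ : ℕ+ => ℂ) 2 k).restrictScalars ℝ
  have hmode : ∀ t, 0 ≤ t → ∀ k,
      x' t k = eigval a k * x t k + component a β b k * u t := fun t ht k => by
    have h := congrArg (componentCLM hβ k) (hsol.state_eq t ht)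
    rw [componentCLM_toXNeg, map_add, componentCLM_genExt, controlOp,
      ContinuousLinearMap.toSpanSingleton_apply, map_smul, componentCLM_apply, smul_eq_mul] at h
    refine h.trans ?_
    ring
  have hxkc : ∀ k, ContinuousOn (fun t => x t k) (Icc 0 τ) := fun k =>
    (ev k).continuous.comp_continuousOn hxc
  have hxkd : ∀ k, ∀ t ∈ Ioo 0 τ, HasDerivAt (fun t => x t k)
      (eigval a k * x t k + component a β b k * u t) t := fun k t ht => by
    have h1 : HasDerivAt x (x' t) t :=
      ((hsol.state_C1.differentiableOn one_ne_zero t ht.1.le).hasDerivWithinAt).hasDerivAt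
        (Ici_mem_nhds ht.1)
    rw [← hmode t ht.1.le k]
    exact (ev k).hasFDerivAt.comp_hasDerivAt t h1
  -- the coefficients of the state are absolutely summable, locally uniformly in time
  set D : ℝ → ℝ := fun t => ‖β • x t - x' t‖ + M₁ * ‖u t‖ with hD
  have hDc : ContinuousOn D (Icc 0 τ) :=
    ((hxc.const_smul β).sub hx'c).norm.add (continuousOn_const.mul huc.norm)
  have hcx : ∀ t, 0 ≤ t → ∀ k, ‖obsComponent a β C k * x t k‖ ≤
      M₂ * D t * ‖(β - eigval a k)⁻¹‖ := fun t ht k => by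
    have h0 := sub_eigval_ne_zero hβ k
    have h1 : x t k = ((β • x t - x' t) k + component a β b k * u t) * (β - eigval a k)⁻¹ := by
      have h2 : (β • x t - x' t) k = β * x t k - x' t k := rfl
      rw [eq_mul_inv_iff_mul_eq₀ h0, h2, hmode t ht k]
      ring
    have h3 : ‖(β • x t - x' t) k + component a β b k * u t‖ ≤ D t := by
      refine (norm_add_le _ _).trans (add_le_add (SeqSpace.norm_apply_le _ _) ?_)
      rw [norm_mul]
      exact mul_le_mul_of_nonneg_right (hb k) (norm_nonneg _)
    rw [norm_mul, h1, norm_mul, ← mul_assoc]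
    refine mul_le_mul_of_nonneg_right ?_ (norm_nonneg _)
    exact mul_le_mul (hc k) h3 (norm_nonneg _) ((norm_nonneg _).trans (hc k))
  have hinv := summable_inv_sub_eigval ha hβ
  have hcxs : ∀ t, 0 ≤ t → Summable fun k => ‖obsComponent a β C k * x t k‖ := fun t ht =>
    Summable.of_nonneg_of_le (fun k => norm_nonneg _) (hcx t ht) (hinv.mul_left _)
  have hy : ∀ t, 0 ≤ t → HasSum (fun k => obsComponent a β C k * x t k) (y t) := fun t ht => by
    obtain ⟨h, hyt⟩ := hsol.output_eq t ht
    rw [hyt, zero_apply, add_zero, lambdaExt_apply ha hβ (hcxs t ht)]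
    exact (hcxs t ht).of_norm.hasSum
  set V := ∫ t in (0 : ℝ)..τ, ‖u t‖ ^ 2
  have hV : 0 ≤ V := intervalIntegral.integral_nonneg hτ.le fun t _ => by positivity
  have hsum : ∀ (z : SeqSpace) (S : Finset ℕ+), ∑ k ∈ S, ‖z k‖ ^ 2 ≤ ‖z‖ ^ 2 := fun z S => by
    rw [SeqSpace.norm_sq_eq_tsum]
    exact (SeqSpace.summable_norm_sq z).sum_le_tsum S fun k _ => sq_nonneg _
  have hxτ : ‖x τ‖ ^ 2 ≤ 2 * ‖x 0‖ ^ 2 + K₁ * V := by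
    rw [SeqSpace.norm_sq_eq_tsum]
    refine (SeqSpace.summable_norm_sq (x τ)).tsum_le_of_sum_le fun S => ?_
    refine (hstate _ u hxkc huc hxkd S).trans ?_
    exact add_le_add (mul_le_mul_of_nonneg_left (hsum _ S) zero_le_two) le_rfl
  have hyint : ∫ t in (0 : ℝ)..τ, ‖y t‖ ^ 2 ≤ K₂ * (‖x 0‖ ^ 2 + ‖x τ‖ ^ 2 + V) := by
    set T := ∑' k, ‖(β - eigval a k)⁻¹‖
    have hM₂ : 0 ≤ M₂ := (norm_nonneg _).trans (hc 1)
    have hlim : Tendsto (fun S : Finset ℕ+ => ∫ t in (0 : ℝ)..τ,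
        ‖∑ k ∈ S, obsComponent a β C k * x t k‖ ^ 2) atTop (𝓝 (∫ t in (0 : ℝ)..τ, ‖y t‖ ^ 2)) := by
      refine intervalIntegral.tendsto_integral_filter_of_dominated_convergence
        (fun t => (M₂ * D t * T) ^ 2) (Eventually.of_forall fun S => ?_)
        (Eventually.of_forall fun S => ?_) ?_ ?_
      · rw [uIoc_of_le hτ.le]
        have : ContinuousOn (fun t => ‖∑ k ∈ S, obsComponent a β C k * x t k‖ ^ 2) (Icc 0 τ) :=
          (continuousOn_finsetSum _ fun k _ => continuousOn_const.mul (hxkc k)).norm.pow 2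
        exact (this.mono Ioc_subset_Icc_self).aestronglyMeasurable measurableSet_Ioc
      · refine Eventually.of_forall fun t ht => ?_
        rw [uIoc_of_le hτ.le] at ht
        rw [norm_pow, norm_norm]
        refine pow_le_pow_left₀ (norm_nonneg _) ?_ 2
        have hD0 : 0 ≤ M₂ * D t :=
          mul_nonneg hM₂ (by have := (norm_nonneg _).trans (hb 1); positivity)
        calc _ ≤ ∑ k ∈ S, M₂ * D t * ‖(β - eigval a k)⁻¹‖ :=
              norm_sum_le_of_le _ fun k _ => hcx t ht.1.le k
          _ = M₂ * D t * ∑ k ∈ S, ‖(β - eigval a k)⁻¹‖ := by rw [Finset.mul_sum]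
          _ ≤ _ := mul_le_mul_of_nonneg_left
              (hinv.sum_le_tsum S fun k _ => norm_nonneg _) hD0
      · exact ((continuousOn_const.mul hDc).mul continuousOn_const).pow 2
          |>.intervalIntegrable_of_Icc hτ.le
      · refine Eventually.of_forall fun t ht => ?_
        rw [uIoc_of_le hτ.le] at ht
        exact (hy t ht.1.le).norm.pow 2
    refine le_of_tendsto hlim (Eventually.of_forall fun S => ?_)
    refine (hout _ u hxkc huc hxkd S).trans (mul_le_mul_of_nonneg_left ?_ hK₂)
    exact add_le_add (add_le_add (hsum _ S) (hsum _ S)) le_rfl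
  set E := ‖x 0‖ ^ 2
  have hE : 0 ≤ E := by positivity
  have h1 : K₂ * (E + ‖x τ‖ ^ 2 + V) ≤ K₂ * (3 * E + (1 + K₁) * V) :=
    mul_le_mul_of_nonneg_left (by linarith) hK₂
  nlinarith [mul_nonneg hK₁ hE, mul_nonneg hK₂ hE, mul_nonneg hK₂ hV, mul_nonneg hK₁ hV,
    mul_nonneg (mul_nonneg hK₂ hK₁) hE, mul_nonneg (mul_nonneg hK₂ hK₁) hV]

end SysNode

end

theorem proposition2p7 (a : ℝ) (ha : 0 < a) :
    SysNode.IsUnitaryGroup (SysNode.diagGroup a) ∧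
    SysNode.IsGenerator (SysNode.diagGroup a) (SysNode.diagOp a) ∧
    ∀ β ∈ SysNode.resolventSet (SysNode.diagOp a),
    ∀ (b : SysNode.XNeg (SysNode.diagOp a) β) (C : SysNode.XOne (SysNode.diagOp a) β →L[ℂ] ℂ),
      SysNode.AdmissibleControl (SysNode.diagGroup a) (SysNode.diagOp a) β
        (SysNode.controlOp a β b) →
      SysNode.AdmissibleObservation (SysNode.diagGroup a) (SysNode.diagOp a) β C →
      SysNode.IsCompatibleSystemNode (SysNode.diagOp a) β (SysNode.controlOp a β b)
        (SysNode.lambdaExt (SysNode.diagOp a) β C) 0 ∧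
      SysNode.WellPosed (SysNode.diagOp a) β (SysNode.controlOp a β b)
        (SysNode.lambdaExt (SysNode.diagOp a) β C) 0 ∧
      SysNode.StrictlyProper
        (SysNode.transferFunction (SysNode.diagOp a) β (SysNode.controlOp a β b)
          (SysNode.lambdaExt (SysNode.diagOp a) β C) 0) ∧
      BddAbove (Set.range fun k : ℕ+ =>
        ‖SysNode.component a β b k * SysNode.obsComponent a β C k‖) ∧
      ∀ s : ℂ, 0 < s.re →
        s ∈ SysNode.resolventSet (SysNode.diagOp a) ∧
        ‖SysNode.transferFunction (SysNode.diagOp a) β (SysNode.controlOp a β b)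
            (SysNode.lambdaExt (SysNode.diagOp a) β C) 0 s 1‖ ≤
          2 * √2 / a *
            (⨆ k : ℕ+, ‖SysNode.component a β b k * SysNode.obsComponent a β C k‖) *
            ∑' k : ℕ, 1 / (s.re / a + (k : ℝ) ^ 2) := by
  refine ⟨SysNode.isUnitaryGroup_diagGroup a, SysNode.isGenerator_diagGroup ha,
    fun β hβ b C hB hC => ?_⟩
  obtain ⟨M₁, hM₁, hb⟩ := SysNode.component_bounded hβ hB
  obtain ⟨M₂, hM₂, hc⟩ := SysNode.obsComponent_bounded hβ hC
  have hbdd : BddAbove (Set.range fun k : ℕ+ =>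
      ‖SysNode.component a β b k * SysNode.obsComponent a β C k‖) := by
    refine ⟨M₁ * M₂, ?_⟩
    rintro _ ⟨k, rfl⟩
    simp only [norm_mul]
    exact mul_le_mul (hb k) (hc k) (norm_nonneg _) hM₁
  -- The transfer function bound accepts any upper bound of |b_k c_k|; the supremum itself is fed
  -- in.
  have hm := fun k => le_ciSup hbdd k
  refine ⟨SysNode.isCompatibleSystemNode_lambdaExt ha hβ hb hc,
    SysNode.wellPosed_lambdaExt ha hβ hb hc,
    SysNode.strictlyProper_transferFunction ha hβ hb hc hm, hbdd, fun s hs =>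
      ⟨SysNode.mem_resolventSet_of_re_pos ha hs, ?_⟩⟩
  simpa only [norm_one, mul_one] using! SysNode.norm_transferFunction_le ha hβ hb hc hm hs 1
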